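/- Let $\mathcal X,\mathcal Y$ be finite sets, $f:\mathcal X\times\mathcal Y\to\{0,1\}$ a function and $\mu$ a probability distribution on $\mathcal X\times\mathcal Y$. A private coins protocol is a finite rooted tree in which each inner node is owned by one of two players (one knows $x\in\mathcal X$, the other knows $y\in\mathcal Y$), its children are leaves or are owned by the other player and are labeled by prefix-free binary strings, and the leaves are labeled by outputs in $\{0,1\}$; the owner of a node moves to a random child, with a distribution that depends on the owner's input, and sends the label of that child. A (public coin) protocol $\pi$ is a discrete probability distribution on private coins protocols; its output is denoted $\pi(x,y)$, its transcript $\Pi$ consists of the public randomness and all messages sent, and its communication cost $CC(\pi)$ is the maximal number of bits sent in any run. Its information cost is $IC_\mu(\pi)=I(\Pi;X|Y)+I(\Pi;Y|X)$ for $(X,Y)\sim\mu$, with information measured in bits, and $$IC_\mu(f,\rho)=\inf\{IC_\mu(\pi)\,:\,\Pr_{(x,y)\sim\mu}[\pi(x,y)\ne f(x,y)]\le\rho\}.$$ Theorem. Suppose that $IC_\mu(f,1/10)=I_\mu$. Then there is a protocol $\pi'$ such that $$CC(\pi')\le\max\{1,\;4220\,I_\mu\}\qquad\text{and}\qquad \Pr_{(x,y)\sim\mu}[\pi'(x,y)=f(x,y)]\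 \ge\ \frac12+2^{-1000(I_\mu+1)-4}.$$ -/

import Mathlib

open scoped ENNReal

noncomputable section

namespace InfoComm

/-! ### Discrete information theory (logarithms to base two) -/

section Information

/-- Probability of an event under a discrete distribution. -/
def prob {Ω : Type*} (p : PMF Ω) (E : Set Ω) : ℝ :=
  (p.toOuterMeasure E).toReal

/-- `H(A | E) = ∑ₐ Pr[A = a | E] log (1 / Pr[A = a | E])`, the entropy of the random variable `A`
conditioned on the event `E`. -/
def entropyGiven {Ω α : Type*} (p : PMF Ω) (A : Ω → α) (E : Set Ω) : ℝ :=
  ∑' a : α, (prob p ({ω | A ω = a} ∩ E) / prob p E) *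
    Real.logb 2 (1 / (prob p ({ω | A ω = a} ∩ E) / prob p E))

/-- Conditional entropy `H(A | B)`, the average over the values `b` of `B` of `H(A | B = b)`. -/
def condEntropy {Ω α β : Type*} (p : PMF Ω) (A : Ω → α) (B : Ω → β) : ℝ :=
  ∑' b : β, prob p {ω | B ω = b} * entropyGiven p A {ω | B ω = b}

/-- Conditional mutual information `I(A ; B | C) = H(A | C) - H(A | B C)`. -/
def condMutualInfo {Ω α β γ : Type*} (p : PMF Ω) (A : Ω → α) (B : Ω → β) (C : Ω → γ) : ℝ :=
  condEntropy p A C - condEntropy p A (fun ω => (B ω, C ω))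

end Information

/-! ### Communication protocols -/

/-- The two players. -/
inductive Player : Type
  | A
  | B

/-- Finite protocol trees with Boolean outputs at the leaves, indexed by the owner of the root.
The children of an inner node are leaves or are owned by the other player, and they are labelled by
binary strings none of which is a prefix of another one. The owner of a node moves to a random
child, whose distribution depends on the owner's input, and sends the label of that child. -/
inductive ProtocolTree (X : Type*) (Y : Type*) : Player → Type _
  | leaf {P : Player} (output : Bool) : ProtocolTree X Y P
  | nodeA {k : ℕ} (label : Fin k → List Bool)
      (prefixFree : ∀ i j, label i <+: label j → i = j)
      (move : X → PMF (Fin k)) (child : Fin k → ProtocolTree X Y Player.B) :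
      ProtocolTree X Y Player.A
  | nodeB {k : ℕ} (label : Fin k → List Bool)
      (prefixFree : ∀ i j, label i <+: label j → i = j)
      (move : Y → PMF (Fin k)) (child : Fin k → ProtocolTree X Y Player.A) :
      ProtocolTree X Y Player.B

/-- The distribution of (list of messages sent, output) on inputs `x` and `y`. -/
def ProtocolTree.run {X Y : Type*} :
    {P : Player} → ProtocolTree X Y P → X → Y → PMF (List (List Bool) × Bool)
  | _, .leaf o, _, _ => PMF.pure ([], o)
  | _, .nodeA label _ move child, x, y =>
      (move x).bind fun i => ((child i).run x y).map fun z => (label i :: z.1, z.2)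
  | _, .nodeB label _ move child, x, y =>
      (move y).bind fun i => ((child i).run x y).map fun z => (label i :: z.1, z.2)

/-- The maximal number of bits sent along a path from the root to a leaf. -/
def ProtocolTree.cost {X Y : Type*} : {P : Player} → ProtocolTree X Y P → ℕ
  | _, .leaf _ => 0
  | _, .nodeA label _ _ child => Finset.univ.sup fun i => (label i).length + (child i).cost
  | _, .nodeB label _ _ child => Finset.univ.sup fun i => (label i).length + (child i).cost

/-- A private coins protocol: a protocol tree, in which either player may own the root. -/
structure PrivateProtocol (X : Type*) (Y : Type*) where
  first : Player
  tree : ProtocolTree X Y first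

/-- A public coin protocol: a distribution on private coins protocols. -/
abbrev Protocol (X : Type*) (Y : Type*) := PMF (PrivateProtocol X Y)

/-- A transcript: the public randomness together with all messages sent. -/
abbrev Transcript (X : Type*) (Y : Type*) := PrivateProtocol X Y × List (List Bool)

/-- Outcome of an execution on random inputs. -/
structure Execution (X : Type*) (Y : Type*) where
  x : X
  y : Y
  transcript : Transcript X Y
  output : Bool

/-- The joint distribution of inputs, transcript and output of `π` when the inputs are drawn
from `μ`, independently of the public randomness. -/
def Protocol.execution {X Y : Type*} (π : Protocol X Y) (μ : PMF (X × Y)) :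
    PMF (Execution X Y) :=
  μ.bind fun xy => π.bind fun r => (r.tree.run xy.1 xy.2).map fun z =>
    { x := xy.1, y := xy.2, transcript := (r, z.1), output := z.2 }

/-- Communication cost: the maximal number of bits sent in any run (infinite if unbounded). -/
def Protocol.commCost {X Y : Type*} (π : Protocol X Y) : ℝ≥0∞ :=
  ⨆ r ∈ π.support, (r.tree.cost : ℝ≥0∞)

/-- `Pr[π(x,y) = f(x,y)]` over `(x,y) ∼ μ` and all the coins of `π`. -/
def Protocol.successProb {X Y : Type*} (π : Protocol X Y) (f : X → Y → Bool) (μ : PMF (X × Y)) :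
    ℝ :=
  prob (π.execution μ) {w | w.output = f w.x w.y}

/-- `Pr[π(x,y) ≠ f(x,y)]` over `(x,y) ∼ μ` and all the coins of `π`. -/
def Protocol.errorProb {X Y : Type*} (π : Protocol X Y) (f : X → Y → Bool) (μ : PMF (X × Y)) :
    ℝ :=
  prob (π.execution μ) {w | w.output ≠ f w.x w.y}

/-- Internal information cost `I(Π ; X | Y) + I(Π ; Y | X)`. Mutual information is symmetric; the
finitely valued inputs are put first, so that all entropies involved are finite even if the public
randomness has infinite support. -/
def Protocol.infoCost {X Y : Type*} (π : Protocol X Y) (μ : PMF (X × Y)) : ℝ :=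
  condMutualInfo (π.execution μ) Execution.x Execution.transcript Execution.y +
    condMutualInfo (π.execution μ) Execution.y Execution.transcript Execution.x

/-- Information complexity `IC_μ(f, ρ)`: the infimum of the information costs of the protocols
that compute `f` with error at most `ρ` over `μ`. -/
def infoComplexity {X Y : Type*} (f : X → Y → Bool) (μ : PMF (X × Y)) (ρ : ℝ) : ℝ :=
  sInf {c : ℝ | ∃ π : Protocol X Y, π.errorProb f μ ≤ ρ ∧ π.infoCost μ = c}

end InfoComm

end

/-! Take a protocol of error at most 1/10 whose information cost is nearly `I`. Two bits suffice
when `4220 * I ≥ 2`, and one bit otherwise.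

Two bits. Averaging over the public coin fixes a private coins tree with a good trade-off between
correlation and information (`exists_channel_of_protocol`). A tree reaches leaf `u` with probability
`a x u * b y u` (`exists_leaves`). Let `α y u` be the average of `a x u` over `x` given `y`, let `β
x u` be the average of `b y u` over `y` given `x`, and put `M = 2 ^ K`. Since the information is
small compared to `K`, with high probability `a ≤ M α` and `b ≤ M β` (`tail_le_channelInfo`). So
`min a (M α) * min (M β) b` can replace `a * b` with a small loss of correlation. A minimum is an
inner product of indicators of intervals, so this kernel is an inner product of a vector depending
on `x` and a vector depending on `y`, both of squared norm at most `M`, because `∑ a β ≤ 1` and `∑ α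
b ≤ 1`. As in proofs of Grothendieck's inequality, projecting on random signs and truncating turns
the vectors into bounded functions of `x` and of `y` whose product has correlation at least `1 / (64
M ^ 3)` with the function (`exists_bounded_of_inner`, `exists_bounded_of_min_kernel`). Bounded
functions can be replaced by signs, and the players exchange these signs.

One bit. If the information is tiny, a Pinsker-type inequality (`variation_le_channelInfo`) shows
that given `x` the transcript hardly depends on `y`, so the first player alone can predict the
output. -/

namespace InfoComm

open Finset

/-! ### Rounding inner products to correlations of bounded functions -/

/-- Random signs: a finite uniform probability space carrying sign variables indexed by `s`, with
the second and fourth moment estimates for their linear combinations. -/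
theorem exists_random_signs {ι : Type*} [DecidableEq ι] (s : Finset ι) :
    ∃ (n : ℕ) (r : ι → Fin (n + 1) → ℝ), ∀ a b : ι → ℝ,
      ∑ ω, (∑ i ∈ s, a i * r i ω) * (∑ i ∈ s, b i * r i ω) = (n + 1) * ∑ i ∈ s, a i * b i ∧
      ∑ ω, (∑ i ∈ s, a i * r i ω) ^ 4 ≤ (n + 1) * (3 * (∑ i ∈ s, a i ^ 2) ^ 2) := by
  -- With an arbitrary finite space the induction can adjoin a fresh coin by passing from `Ω` to `Ω
  -- × Bool`; `Fin (n + 1)` is restored by transport.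
  suffices h : ∃ (Ω : Type) (_ : Fintype Ω) (_ : Nonempty Ω) (r : ι → Ω → ℝ), ∀ a b : ι → ℝ,
      ∑ ω, (∑ i ∈ s, a i * r i ω) * (∑ i ∈ s, b i * r i ω)
        = Fintype.card Ω * ∑ i ∈ s, a i * b i ∧
      ∑ ω, (∑ i ∈ s, a i * r i ω) ^ 4 ≤ Fintype.card Ω * (3 * (∑ i ∈ s, a i ^ 2) ^ 2) by
    obtain ⟨Ω, _, hne, r, hr⟩ := h
    obtain ⟨n, hn⟩ : ∃ n, Fintype.card Ω = n + 1 :=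
      Nat.exists_eq_succ_of_ne_zero Fintype.card_ne_zero
    let e : Fin (n + 1) ≃ Ω := (finCongr hn.symm).trans (Fintype.equivFin Ω).symm
    refine ⟨n, fun i ω => r i (e ω), fun a b => ?_⟩
    have h := hr a b
    rw [hn] at h
    push_cast at h
    rw [← h.1]
    refine ⟨e.sum_comp fun ω => (∑ i ∈ s, a i * r i ω) * (∑ i ∈ s, b i * r i ω), ?_⟩
    exact (e.sum_comp fun ω => (∑ i ∈ s, a i * r i ω) ^ 4).le.trans h.2
  induction s using Finset.induction_on with
  | empty => exact ⟨Unit, inferInstance, inferInstance, fun _ _ => 0, by simp⟩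
  | insert j s hj ih =>
    obtain ⟨Ω, _, _, r, hr⟩ := ih
    let sg : Bool → ℝ := fun c => if c then 1 else -1
    refine ⟨Ω × Bool, inferInstance, inferInstance,
      fun i ω => if i = j then sg ω.2 else r i ω.1, fun a b => ?_⟩
    have key : ∀ (a : ι → ℝ) (ω : Ω × Bool),
        ∑ i ∈ insert j s, a i * (if i = j then sg ω.2 else r i ω.1)
          = a j * sg ω.2 + ∑ i ∈ s, a i * r i ω.1 := by
      intro a ω
      rw [Finset.sum_insert hj, if_pos rfl]
      congr 1
      refine Finset.sum_congr rfl fun i hi => ?_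
      rw [if_neg (ne_of_mem_of_not_mem hi hj)]
    simp only [key, Fintype.card_prod, Fintype.card_bool, Finset.sum_insert hj]
    obtain ⟨h1, h2⟩ := hr a b
    have h3 := (hr a a).1
    constructor
    · have : ∑ ω : Ω × Bool, (a j * sg ω.2 + ∑ i ∈ s, a i * r i ω.1) *
          (b j * sg ω.2 + ∑ i ∈ s, b i * r i ω.1)
          = ∑ ω, (2 * (a j * b j) + 2 * ((∑ i ∈ s, a i * r i ω) * ∑ i ∈ s, b i * r i ω)) := by
        rw [Fintype.sum_prod_type]
        refine Finset.sum_congr rfl fun ω _ => ?_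
        rw [Fintype.sum_bool]
        simp only [sg, if_true, Bool.false_eq_true, if_false]
        ring
      rw [this, Finset.sum_add_distrib, Finset.sum_const, Finset.card_univ,
        nsmul_eq_mul, ← Finset.mul_sum, h1]
      push_cast; ring
    -- Odd powers of the new sign cancel. With `S` the sum of the old squares, the normalised fourth
    -- moment is at most `a j ^ 4 + 6 * a j ^ 2 * S + 3 * S ^ 2`, which is at most `3 * (a j ^ 2 +
    -- S) ^ 2`.
    · have : ∑ ω : Ω × Bool, (a j * sg ω.2 + ∑ i ∈ s, a i * r i ω.1) ^ 4
          = ∑ ω, (2 * a j ^ 4 + 12 * a j ^ 2 * ((∑ i ∈ s, a i * r i ω) * ∑ i ∈ s, a i * r i ω) +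
            2 * (∑ i ∈ s, a i * r i ω) ^ 4) := by
        rw [Fintype.sum_prod_type]
        refine Finset.sum_congr rfl fun ω _ => ?_
        rw [Fintype.sum_bool]
        simp only [sg, if_true, Bool.false_eq_true, if_false]
        ring
      rw [this, Finset.sum_add_distrib, Finset.sum_add_distrib, ← Finset.mul_sum,
        ← Finset.mul_sum, ← Finset.mul_sum, h3, Finset.sum_const, Finset.card_univ, nsmul_eq_mul]
      simp only [← pow_two]
      push_cast
      have h5 : (0 : ℝ) ≤ Fintype.card Ω * a j ^ 4 := by positivity
      nlinarith [h2, h5]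

/-- Truncation of a real number to `[-L, L]`. -/
def clamp (L t : ℝ) : ℝ := max (-L) (min t L)

theorem abs_clamp_le {L : ℝ} (hL : 0 ≤ L) (t : ℝ) : |clamp L t| ≤ L := by
  rw [abs_le, clamp]
  exact ⟨le_max_left _ _, max_le (by linarith) (min_le_right _ _)⟩

theorem abs_clamp_le_abs {L : ℝ} (hL : 0 ≤ L) (t : ℝ) : |clamp L t| ≤ |t| := by
  rw [abs_le, clamp]
  constructor
  · refine le_max_of_le_right (le_min (neg_abs_le t) (by linarith [abs_nonneg t]))
  · exact max_le (by linarith [abs_nonneg t]) ((min_le_left _ _).trans (le_abs_self t))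

/-- The excess `|t| - L` lies below a parabola tangent to it at `|t| = 2 * L`. A quadratic bound
lets moments control the truncation loss. -/
theorem abs_sub_clamp_le {L : ℝ} (hL : 0 < L) (t : ℝ) : |t - clamp L t| ≤ t ^ 2 / (4 * L) := by
  have h : ∀ s : ℝ, s - L ≤ s ^ 2 / (4 * L) := by
    intro s
    rw [le_div_iff₀ (by positivity)]
    nlinarith [sq_nonneg (s - 2 * L)]
  have h1 := h t
  have h2 := h (-t)
  rw [neg_sq] at h2
  have h0 : 0 ≤ t ^ 2 / (4 * L) := by positivity
  rw [clamp, abs_le]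
  rcases max_cases (-L) (min t L) with ⟨e, _⟩ | ⟨e, _⟩ <;>
    rcases min_cases t L with ⟨e', _⟩ | ⟨e', _⟩ <;> rw [e] <;> constructor <;> linarith

/-- The pointwise loss when two factors are truncated. -/
theorem abs_mul_sub_clamp_le {R : ℝ} (hR : 0 < R) (s t : ℝ) :
    |s * t - clamp (4 * R ^ 3) s * clamp (4 * R ^ 3) t| ≤
      (s ^ 4 / R + R * t ^ 2 + (t ^ 4 / R + R * s ^ 2)) / (32 * R ^ 3) := by
  have hL : 0 < 4 * R ^ 3 := by positivity
  have e : s * t - clamp (4 * R ^ 3) s * clamp (4 * R ^ 3) t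
      = (s - clamp (4 * R ^ 3) s) * t + clamp (4 * R ^ 3) s * (t - clamp (4 * R ^ 3) t) := by ring
  -- The weight `R` balances the two terms when fourth moments are of order `R ^ 4` and second
  -- moments of order `R ^ 2`.
  have amgm : ∀ p q : ℝ, p ^ 2 * |q| ≤ (p ^ 4 / R + R * q ^ 2) / 2 := by
    intro p q
    have h : 0 ≤ (p ^ 2 - R * |q|) ^ 2 / R := by positivity
    have h' : (p ^ 2 - R * |q|) ^ 2 / R = p ^ 4 / R + R * q ^ 2 - 2 * (p ^ 2 * |q|) := by
      rw [← sq_abs q]; field_simp; ring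
    linarith
  rw [e]
  have h1 := abs_sub_clamp_le hL s
  have h2 := abs_sub_clamp_le hL t
  have h3 := abs_clamp_le_abs hL.le s
  calc _ ≤ |s - clamp (4 * R ^ 3) s| * |t| + |clamp (4 * R ^ 3) s| * |t - clamp (4 * R ^ 3) t| := by
        rw [← abs_mul, ← abs_mul]; exact abs_add_le _ _
    _ ≤ s ^ 2 / (4 * (4 * R ^ 3)) * |t| + |s| * (t ^ 2 / (4 * (4 * R ^ 3))) := by gcongr
    _ = (s ^ 2 * |t| + t ^ 2 * |s|) / (16 * R ^ 3) := by field_simp; ring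
    _ ≤ ((s ^ 4 / R + R * t ^ 2) / 2 + (t ^ 4 / R + R * s ^ 2) / 2) / (16 * R ^ 3) := by
        gcongr
        · exact amgm s t
        · exact amgm t s
    _ = _ := by field_simp; ring

/-- If `∑ W(x,y) ⟨a x, b y⟩` is large for vectors of norm at most `R`, then `W` correlates with a
product of two functions bounded by one. -/
theorem exists_bounded_of_inner {X Y ι : Type*} [Fintype X] [Fintype Y] [Fintype ι]
    (a : X → ι → ℝ) (b : Y → ι → ℝ) (W : X → Y → ℝ) {R : ℝ} (hR : 0 < R)
    (ha : ∀ x, ∑ i, a x i ^ 2 ≤ R ^ 2) (hb : ∀ y, ∑ i, b y i ^ 2 ≤ R ^ 2)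
    (hW : ∑ x, ∑ y, |W x y| ≤ 1) :
    ∃ (g : X → ℝ) (h : Y → ℝ), (∀ x, |g x| ≤ 1) ∧ (∀ y, |h y| ≤ 1) ∧
      ((∑ x, ∑ y, W x y * ∑ i, a x i * b y i) - 1 / 4) / (16 * R ^ 6)
        ≤ ∑ x, ∑ y, W x y * (g x * h y) := by
  classical
  obtain ⟨n, r, hr⟩ := exists_random_signs (Finset.univ : Finset ι)
  set L := 4 * R ^ 3 with hLdef
  have hL : 0 < L := by positivity
  set ξ : X → Fin (n + 1) → ℝ := fun x ω => ∑ i, a x i * r i ω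
  set η : Y → Fin (n + 1) → ℝ := fun y ω => ∑ i, b y i * r i ω
  have hn : (0 : ℝ) < n + 1 := by positivity
  have moment4 : ∀ c : ι → ℝ, ∑ i, c i ^ 2 ≤ R ^ 2 →
      ∑ ω, (∑ i, c i * r i ω) ^ 4 ≤ (n + 1) * (3 * R ^ 4) := by
    intro c hc
    refine (hr c c).2.trans ?_
    have h0 : 0 ≤ ∑ i, c i ^ 2 := Finset.sum_nonneg fun i _ => sq_nonneg _
    have : (∑ i, c i ^ 2) ^ 2 ≤ (R ^ 2) ^ 2 := by gcongr
    have e : (R ^ 2) ^ 2 = R ^ 4 := by ring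
    rw [e] at this
    gcongr
  have moment2 : ∀ c : ι → ℝ, ∑ i, c i ^ 2 ≤ R ^ 2 →
      ∑ ω, (∑ i, c i * r i ω) ^ 2 ≤ (n + 1) * R ^ 2 := by
    intro c hc
    simp only [pow_two (∑ i, c i * r i _)]
    rw [(hr c c).1]
    simp only [← pow_two]
    gcongr
  -- The moments contribute `2 * (3 + 1) * R ^ 3` on average, over `32 * R ^ 3`: the level `L = 4 *
  -- R ^ 3` is chosen to make the loss 1/4.
  have pair : ∀ x y, |(n + 1) * ∑ i, a x i * b y i - ∑ ω, clamp L (ξ x ω) * clamp L (η y ω)|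
      ≤ (n + 1) * (1 / 4) := by
    intro x y
    rw [← (hr (a x) (b y)).1, ← Finset.sum_sub_distrib]
    refine (Finset.abs_sum_le_sum_abs _ _).trans ?_
    refine (Finset.sum_le_sum fun ω _ => abs_mul_sub_clamp_le hR (ξ x ω) (η y ω)).trans ?_
    rw [← Finset.sum_div, Finset.sum_add_distrib, Finset.sum_add_distrib, Finset.sum_add_distrib,
      ← Finset.sum_div, ← Finset.sum_div, ← Finset.mul_sum, ← Finset.mul_sum]
    have h1 := moment4 _ (ha x)
    have h2 := moment4 _ (hb y)
    have h3 := moment2 _ (ha x)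
    have h4 := moment2 _ (hb y)
    calc _ ≤ ((n + 1) * (3 * R ^ 4) / R + R * ((n + 1) * R ^ 2) +
          ((n + 1) * (3 * R ^ 4) / R + R * ((n + 1) * R ^ 2))) / (32 * R ^ 3) := by gcongr
      _ = (n + 1) * (1 / 4) := by field_simp; ring
  -- If no pair of bounded functions works, then neither do the truncated projections divided by
  -- `L`, for any `ω`; averaging over `ω` contradicts `pair`.
  by_contra! hcon
  have hub : ∀ ω : Fin (n + 1), ∑ x, ∑ y, W x y * (clamp L (ξ x ω) * clamp L (η y ω))
      < (∑ x, ∑ y, W x y * ∑ i, a x i * b y i) - 1 / 4 := by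
    intro ω
    have := hcon (fun x => clamp L (ξ x ω) / L) (fun y => clamp L (η y ω) / L)
      (fun x => by rw [abs_div, abs_of_pos hL]; exact div_le_one_of_le₀ (abs_clamp_le hL.le _) hL.le)
      (fun y => by rw [abs_div, abs_of_pos hL]; exact div_le_one_of_le₀ (abs_clamp_le hL.le _) hL.le)
    rw [lt_div_iff₀ (by positivity)] at this
    refine lt_of_eq_of_lt ?_ this
    rw [Finset.sum_mul]
    refine Finset.sum_congr rfl fun x _ => ?_
    rw [Finset.sum_mul]
    refine Finset.sum_congr rfl fun y _ => ?_
    have : (16 : ℝ) * R ^ 6 = L * L := by rw [hLdef]; ring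
    rw [this]
    field_simp
  have hsum := Finset.sum_lt_sum_of_nonempty (s := (Finset.univ : Finset (Fin (n + 1))))
    ⟨0, Finset.mem_univ _⟩ fun ω _ => hub ω
  rw [Finset.sum_const, Finset.card_univ, Fintype.card_fin, nsmul_eq_mul] at hsum
  push_cast at hsum
  rw [Finset.sum_comm] at hsum
  have hsw : ∀ x, ∑ ω, ∑ y, W x y * (clamp L (ξ x ω) * clamp L (η y ω))
      = ∑ y, W x y * ∑ ω, clamp L (ξ x ω) * clamp L (η y ω) := by
    intro x
    rw [Finset.sum_comm]
    exact Finset.sum_congr rfl fun y _ => (Finset.mul_sum _ _ _).symm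
  simp only [hsw] at hsum
  have hdiff : (n + 1) * (∑ x, ∑ y, W x y * ∑ i, a x i * b y i)
      - ∑ x, ∑ y, W x y * ∑ ω, clamp L (ξ x ω) * clamp L (η y ω) ≤ (n + 1) * (1 / 4) := by
    rw [Finset.mul_sum, ← Finset.sum_sub_distrib]
    calc _ ≤ ∑ x, ∑ y, |W x y| * ((n + 1) * (1 / 4)) := by
          refine Finset.sum_le_sum fun x _ => ?_
          rw [Finset.mul_sum, ← Finset.sum_sub_distrib]
          refine Finset.sum_le_sum fun y _ => ?_
          have := mul_le_mul_of_nonneg_left (pair x y) (abs_nonneg (W x y))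
          rw [← abs_mul] at this
          refine le_trans (le_trans (le_of_eq ?_) (le_abs_self _)) this
          ring
      _ = (∑ x, ∑ y, |W x y|) * ((n + 1) * (1 / 4)) := by simp only [Finset.sum_mul]
      _ ≤ 1 * ((n + 1) * (1 / 4)) := by gcongr
      _ = _ := one_mul _
  linarith

/-- The kernel `∑ᵤ o(u) min(p x u, p' y u) min(q x u, q' y u)` is an inner product of vectors whose
norms are controlled by `∑ p q` and `∑ p' q'`; rounding it yields bounded functions. -/
theorem exists_bounded_of_min_kernel {X Y U : Type*} [Fintype X] [Fintype Y] [Fintype U]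
    (p q : X → U → ℝ) (p' q' : Y → U → ℝ) (o : U → ℝ) (W : X → Y → ℝ) {R : ℝ} (hR : 0 < R)
    (hp : ∀ x u, 0 ≤ p x u) (hq : ∀ x u, 0 ≤ q x u)
    (hp' : ∀ y u, 0 ≤ p' y u) (hq' : ∀ y u, 0 ≤ q' y u)
    (ho : ∀ u, |o u| ≤ 1)
    (ha : ∀ x, ∑ u, p x u * q x u ≤ R ^ 2) (hb : ∀ y, ∑ u, p' y u * q' y u ≤ R ^ 2)
    (hW : ∑ x, ∑ y, |W x y| ≤ 1)
    (hlarge : 1 / 2 <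
      ∑ x, ∑ y, W x y * ∑ u, o u * (min (p x u) (p' y u) * min (q x u) (q' y u))) :
    ∃ (g : X → ℝ) (h : Y → ℝ), (∀ x, |g x| ≤ 1) ∧ (∀ y, |h y| ≤ 1) ∧
      1 / (64 * R ^ 6) ≤ ∑ x, ∑ y, W x y * (g x * h y) := by
  classical
  -- Rounding down to multiples of `1 / N` does not increase the norms, and the strict inequality
  -- `hlarge` survives for large `N`.
  let d : ℕ → ℝ → ℝ := fun N s => (⌊s * N⌋₊ : ℝ) / N
  have hd : ∀ s, 0 ≤ s → Filter.Tendsto (fun N => d N s) Filter.atTop (nhds s) := fun s hs =>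
    (tendsto_nat_floor_mul_div_atTop hs).comp tendsto_natCast_atTop_atTop
  have hlim : Filter.Tendsto (fun N => ∑ x, ∑ y, W x y * ∑ u, o u *
      (min (d N (p x u)) (d N (p' y u)) * min (d N (q x u)) (d N (q' y u)))) Filter.atTop
      (nhds (∑ x, ∑ y, W x y * ∑ u, o u * (min (p x u) (p' y u) * min (q x u) (q' y u)))) := by
    refine tendsto_finsetSum _ fun x _ => tendsto_finsetSum _ fun y _ => ?_
    refine Filter.Tendsto.const_mul _ (tendsto_finsetSum _ fun u _ => ?_)
    refine Filter.Tendsto.const_mul _ (Filter.Tendsto.mul ?_ ?_)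
    · exact (hd _ (hp x u)).min (hd _ (hp' y u))
    · exact (hd _ (hq x u)).min (hd _ (hq' y u))
  obtain ⟨N, hN, hN1⟩ := ((hlim.eventually (lt_mem_nhds hlarge)).and
    (Filter.eventually_ge_atTop 1)).exists
  have hNpos : (0 : ℝ) < N := by exact_mod_cast hN1
  obtain ⟨m, hm⟩ : ∃ m : ℕ, (∀ x u, ⌊p x u * N⌋₊ ≤ m ∧ ⌊q x u * N⌋₊ ≤ m) ∧
      ∀ y u, ⌊p' y u * N⌋₊ ≤ m ∧ ⌊q' y u * N⌋₊ ≤ m := by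
    refine ⟨∑ x, ∑ u, (⌊p x u * N⌋₊ + ⌊q x u * N⌋₊) + ∑ y, ∑ u, (⌊p' y u * N⌋₊ + ⌊q' y u * N⌋₊),
      fun x u => ?_, fun y u => ?_⟩
    · have h1 := Finset.single_le_sum (f := fun x => ∑ u, (⌊p x u * N⌋₊ + ⌊q x u * N⌋₊))
        (fun _ _ => Nat.zero_le _) (Finset.mem_univ x)
      have h2 := Finset.single_le_sum (f := fun u => (⌊p x u * N⌋₊ + ⌊q x u * N⌋₊))
        (fun _ _ => Nat.zero_le _) (Finset.mem_univ u)
      omega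
    · have h1 := Finset.single_le_sum (f := fun y => ∑ u, (⌊p' y u * N⌋₊ + ⌊q' y u * N⌋₊))
        (fun _ _ => Nat.zero_le _) (Finset.mem_univ y)
      have h2 := Finset.single_le_sum (f := fun u => (⌊p' y u * N⌋₊ + ⌊q' y u * N⌋₊))
        (fun _ _ => Nat.zero_le _) (Finset.mem_univ u)
      omega
  have count : ∀ k l : ℕ, k ≤ m → l ≤ m →
      ∑ i : Fin m, (if (i : ℕ) < k then (1 : ℝ) else 0) * (if (i : ℕ) < l then 1 else 0)
        = min (k : ℝ) l := by
    intro k l hk hl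
    rw [Fin.sum_univ_eq_sum_range
      (fun i => (if i < k then (1 : ℝ) else 0) * (if i < l then 1 else 0)) m]
    have : ∀ i : ℕ, (if i < k then (1 : ℝ) else 0) * (if i < l then 1 else 0)
        = if i < min k l then 1 else 0 := by
      intro i
      by_cases h1 : i < k <;> by_cases h2 : i < l <;> simp [h1, h2]
    simp only [this]
    rw [Finset.sum_boole, ← Nat.cast_min]
    congr 1
    have : (Finset.range m).filter (fun i => i < min k l) = Finset.range (min k l) := by
      ext i; simp only [Finset.mem_filter, Finset.mem_range]; omega
    rw [this, Finset.card_range]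
  -- The indicator of a `k` by `l` rectangle of cells: the inner product of two such indicators is
  -- the product of the minima of the side lengths.
  let box : ℕ → ℕ → Fin m × Fin m → ℝ := fun k l ij =>
    (if (ij.1 : ℕ) < k then (1 : ℝ) else 0) * (if (ij.2 : ℕ) < l then 1 else 0)
  have box_mul : ∀ k l k' l' : ℕ, k ≤ m → l ≤ m → k' ≤ m → l' ≤ m →
      ∑ ij, box k l ij * box k' l' ij = min (k : ℝ) k' * min (l : ℝ) l' := by
    intro k l k' l' h1 h2 h3 h4
    rw [← count k k' h1 h3, ← count l l' h2 h4, Fintype.sum_prod_type, Finset.sum_mul_sum]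
    refine Finset.sum_congr rfl fun i _ => Finset.sum_congr rfl fun j _ => ?_
    simp only [box]; ring
  have floor_le : ∀ s t : ℝ, 0 ≤ s → 0 ≤ t →
      (⌊s * N⌋₊ : ℝ) * ⌊t * N⌋₊ / N ^ 2 ≤ s * t := by
    intro s t hs ht
    rw [div_le_iff₀ (by positivity)]
    calc (⌊s * N⌋₊ : ℝ) * ⌊t * N⌋₊ ≤ (s * N) * (t * N) := by
          gcongr
          · exact Nat.floor_le (by positivity)
          · exact Nat.floor_le (by positivity)
      _ = _ := by ring
  obtain ⟨g, h, hg, hh, H⟩ := exists_bounded_of_inner (ι := U × (Fin m × Fin m))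
    (fun x i => box ⌊p x i.1 * N⌋₊ ⌊q x i.1 * N⌋₊ i.2 / N)
    (fun y i => o i.1 * box ⌊p' y i.1 * N⌋₊ ⌊q' y i.1 * N⌋₊ i.2 / N) W hR
    (by
      intro x
      refine le_trans ?_ (ha x)
      rw [Fintype.sum_prod_type]
      refine Finset.sum_le_sum fun u _ => ?_
      simp only [div_pow, ← Finset.sum_div]
      simp only [pow_two (box _ _ _)]
      rw [box_mul _ _ _ _ (hm.1 x u).1 (hm.1 x u).2 (hm.1 x u).1 (hm.1 x u).2, min_self, min_self]
      exact floor_le _ _ (hp x u) (hq x u))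
    (by
      intro y
      refine le_trans ?_ (hb y)
      rw [Fintype.sum_prod_type]
      refine Finset.sum_le_sum fun u _ => ?_
      have e : ∀ ij, (o u * box ⌊p' y u * N⌋₊ ⌊q' y u * N⌋₊ ij / N) ^ 2
          = o u ^ 2 * ((box ⌊p' y u * N⌋₊ ⌊q' y u * N⌋₊ ij *
            box ⌊p' y u * N⌋₊ ⌊q' y u * N⌋₊ ij) / N ^ 2) := by
        intro ij; ring
      simp only [e, ← Finset.mul_sum, ← Finset.sum_div]
      rw [box_mul _ _ _ _ (hm.2 y u).1 (hm.2 y u).2 (hm.2 y u).1 (hm.2 y u).2, min_self, min_self]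
      have h1 := floor_le _ _ (hp' y u) (hq' y u)
      have h2 : o u ^ 2 ≤ 1 := (sq_le_one_iff_abs_le_one _).2 (ho u)
      have h3 : (0 : ℝ) ≤ (⌊p' y u * N⌋₊ : ℝ) * ⌊q' y u * N⌋₊ / N ^ 2 := by positivity
      nlinarith)
    hW
  refine ⟨g, h, hg, hh, le_trans ?_ H⟩
  have hk : ∀ x y, ∑ i : U × (Fin m × Fin m), box ⌊p x i.1 * N⌋₊ ⌊q x i.1 * N⌋₊ i.2 / N *
      (o i.1 * box ⌊p' y i.1 * N⌋₊ ⌊q' y i.1 * N⌋₊ i.2 / N)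
      = ∑ u, o u * (min (d N (p x u)) (d N (p' y u)) * min (d N (q x u)) (d N (q' y u))) := by
    intro x y
    rw [Fintype.sum_prod_type]
    refine Finset.sum_congr rfl fun u _ => ?_
    have e : ∀ ij, box ⌊p x u * N⌋₊ ⌊q x u * N⌋₊ ij / N *
        (o u * box ⌊p' y u * N⌋₊ ⌊q' y u * N⌋₊ ij / N)
        = o u * ((box ⌊p x u * N⌋₊ ⌊q x u * N⌋₊ ij *
            box ⌊p' y u * N⌋₊ ⌊q' y u * N⌋₊ ij) / N ^ 2) := by
      intro ij; ring
    simp only [e, ← Finset.mul_sum, ← Finset.sum_div]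
    rw [box_mul _ _ _ _ (hm.1 x u).1 (hm.1 x u).2 (hm.2 y u).1 (hm.2 y u).2]
    simp only [d]
    rw [min_div_div_right hNpos.le, min_div_div_right hNpos.le]
    ring
  simp only [hk]
  rw [div_le_div_iff₀ (by positivity) (by positivity)]
  have : (0 : ℝ) < R ^ 6 := by positivity
  nlinarith

/-! ### Information of a finite channel -/

section FiniteInformation

variable {X Y U : Type*} [Fintype X] [Fintype Y] [Fintype U]

/-- `I(U ; X | Y)` in bits, for `(X, Y)` distributed according to `w` and `U` distributed
according to `Q x y` given `(x, y)`. -/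
noncomputable def channelInfo (w : X → Y → ℝ) (Q : X → Y → U → ℝ) : ℝ :=
  ∑ y, ∑ x, w x y * ∑ u, Q x y u *
    Real.logb 2 (Q x y u * (∑ x', w x' y) / ∑ x', w x' y * Q x' y u)

/-- A pointwise bound of `φ` by a logarithm and a reciprocal, applied to the likelihood ratio
between `Q x y` and its average over `x` given `y`, bounds the average of `φ` by the
information. -/
theorem sum_mul_le_channelInfo (w : X → Y → ℝ) (Q : X → Y → U → ℝ)
    (hw : ∀ x y, 0 ≤ w x y) (hw1 : ∑ y, ∑ x, w x y = 1)
    (hQ : ∀ x y u, 0 ≤ Q x y u) (hQ1 : ∀ x y, ∑ u, Q x y u = 1)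
    (φ : ℝ → ℝ) {A B C : ℝ} (hC : 0 ≤ C)
    (hφ : ∀ ρ, 0 < ρ → φ ρ ≤ A * Real.logb 2 ρ + B + C / ρ) :
    ∑ y, ∑ x, w x y * ∑ u, Q x y u * φ (Q x y u * (∑ x', w x' y) / ∑ x', w x' y * Q x' y u)
      ≤ A * channelInfo w Q + B + C := by
  have hS0 : ∀ y u, 0 ≤ ∑ x', w x' y * Q x' y u := fun y u =>
    Finset.sum_nonneg fun x _ => mul_nonneg (hw x y) (hQ x y u)
  have hW0 : ∀ y, 0 ≤ ∑ x', w x' y := fun y => Finset.sum_nonneg fun x _ => hw x y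
  -- Multiplying `C / ρ` by `Q x y u` gives `C` times the average of `Q` given `y`, whose sum over
  -- `u` is at most one. Points with `Q x y u = 0`, where `hφ` says nothing, cost nothing since `0 ≤
  -- C`.
  have term : ∀ y x u,
      w x y * (Q x y u * φ (Q x y u * (∑ x', w x' y) / ∑ x', w x' y * Q x' y u)) ≤
      A * (w x y * (Q x y u * Real.logb 2 (Q x y u * (∑ x', w x' y) / ∑ x', w x' y * Q x' y u)))
        + B * (w x y * Q x y u) +
        C * (w x y * ((∑ x', w x' y * Q x' y u) / ∑ x', w x' y)) := by
    intro y x u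
    have hlast : 0 ≤ C * (w x y * ((∑ x', w x' y * Q x' y u) / ∑ x', w x' y)) :=
      mul_nonneg hC (mul_nonneg (hw x y) (div_nonneg (hS0 y u) (hW0 y)))
    rcases (hw x y).eq_or_lt with h | hwp
    · rw [← h]; simp
    rcases (hQ x y u).eq_or_lt with h | hQp
    · rw [← h] ; simpa using hlast
    have hSp : 0 < ∑ x', w x' y * Q x' y u := lt_of_lt_of_le (mul_pos hwp hQp)
      (Finset.single_le_sum (f := fun x' => w x' y * Q x' y u)
        (fun x' _ => mul_nonneg (hw x' y) (hQ x' y u)) (Finset.mem_univ x))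
    have hWp : 0 < ∑ x', w x' y := lt_of_lt_of_le hwp
      (Finset.single_le_sum (f := fun x' => w x' y) (fun x' _ => hw x' y) (Finset.mem_univ x))
    have h := hφ (Q x y u * (∑ x', w x' y) / ∑ x', w x' y * Q x' y u) (by positivity)
    have h' := mul_le_mul_of_nonneg_left h (mul_pos hwp hQp).le
    refine le_trans (le_of_eq (by ring)) (h'.trans (le_of_eq ?_))
    field_simp
  have hsum : ∑ y, ∑ x, ∑ u,
      w x y * (Q x y u * φ (Q x y u * (∑ x', w x' y) / ∑ x', w x' y * Q x' y u)) ≤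
      ∑ y, ∑ x, ∑ u,
      (A * (w x y * (Q x y u * Real.logb 2 (Q x y u * (∑ x', w x' y) / ∑ x', w x' y * Q x' y u)))
        + B * (w x y * Q x y u) +
        C * (w x y * ((∑ x', w x' y * Q x' y u) / ∑ x', w x' y))) :=
    Finset.sum_le_sum fun y _ => Finset.sum_le_sum fun x _ => Finset.sum_le_sum fun u _ =>
      term y x u
  simp only [Finset.sum_add_distrib, ← Finset.mul_sum] at hsum
  have h2 : ∑ y, ∑ x, w x y * ∑ u, Q x y u = 1 := by simp only [hQ1, mul_one, hw1]
  have h3 : ∑ y, ∑ x, w x y * ∑ u, ((∑ x', w x' y * Q x' y u) / ∑ x', w x' y) ≤ 1 := by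
    rw [← hw1]
    refine Finset.sum_le_sum fun y _ => Finset.sum_le_sum fun x _ => ?_
    refine mul_le_of_le_one_right (hw x y) ?_
    rw [← Finset.sum_div, Finset.sum_comm]
    simp only [← Finset.mul_sum, hQ1, mul_one]
    exact div_self_le_one _
  rw [h2] at hsum
  refine hsum.trans ?_
  rw [channelInfo]
  nlinarith

/-- The probability that the likelihood ratio exceeds `2 ^ K`. -/
theorem tail_le_channelInfo (w : X → Y → ℝ) (Q : X → Y → U → ℝ)
    (hw : ∀ x y, 0 ≤ w x y) (hw1 : ∑ y, ∑ x, w x y = 1)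
    (hQ : ∀ x y u, 0 ≤ Q x y u) (hQ1 : ∀ x y, ∑ u, Q x y u = 1) {K : ℝ} (hK : 0 < K) :
    ∑ y, ∑ x, w x y * ∑ u, Q x y u *
      (if 2 ^ K < Q x y u * (∑ x', w x' y) / ∑ x', w x' y * Q x' y u then (1 : ℝ) else 0)
      ≤ (channelInfo w Q + 2) / K := by
  have h := sum_mul_le_channelInfo w Q hw hw1 hQ hQ1
    (fun ρ => if 2 ^ K < ρ then (1 : ℝ) else 0) (A := 1 / K) (B := 0) (C := 2 / K)
    (by positivity) ?_
  · refine h.trans (le_of_eq ?_)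
    field_simp; ring
  · intro ρ hρ
    -- The logarithm may be negative, so Markov's inequality is applied to this nonnegative
    -- majorant.
    have hlog : 0 ≤ Real.logb 2 ρ + 2 / ρ := by
      have h1 : Real.log ρ⁻¹ ≤ ρ⁻¹ := by
        have := Real.log_le_sub_one_of_pos (inv_pos.2 hρ); linarith
      rw [Real.log_inv] at h1
      have h2 : (1 : ℝ) / 2 ≤ Real.log 2 := by have := Real.log_two_gt_d9; linarith
      have h3 : Real.logb 2 ρ + 2 / ρ = (Real.log ρ + 2 * Real.log 2 * ρ⁻¹) / Real.log 2 := by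
        rw [Real.logb]; field_simp
      rw [h3]
      have : 0 < ρ⁻¹ := inv_pos.2 hρ
      apply div_nonneg _ (by linarith)
      nlinarith
    show (if 2 ^ K < ρ then (1 : ℝ) else 0) ≤ _
    have e : 1 / K * Real.logb 2 ρ + 0 + 2 / K / ρ = (Real.logb 2 ρ + 2 / ρ) / K := by
      field_simp; ring
    rw [e]
    split_ifs with hlt
    · rw [le_div_iff₀ hK, one_mul]
      have h1 : K ≤ Real.logb 2 ρ := by
        rw [Real.le_logb_iff_rpow_le (by norm_num) hρ]; exact hlt.le
      have : 0 < 2 / ρ := by positivity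
      linarith
    · positivity

/-- A linear form of Pinsker's inequality: the expected positive part of the difference between
`Q x y` and its average over `x` given `y`. -/
theorem variation_le_channelInfo (w : X → Y → ℝ) (Q : X → Y → U → ℝ)
    (hw : ∀ x y, 0 ≤ w x y) (hw1 : ∑ y, ∑ x, w x y = 1)
    (hQ : ∀ x y u, 0 ≤ Q x y u) (hQ1 : ∀ x y, ∑ u, Q x y u = 1) {c : ℝ} (hc : 0 < c) :
    ∑ y, ∑ x, w x y * ∑ u, Q x y u *
      max 0 (1 - 1 / (Q x y u * (∑ x', w x' y) / ∑ x', w x' y * Q x' y u))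
      ≤ c * Real.log 2 * channelInfo w Q + 1 / c := by
  have h := sum_mul_le_channelInfo w Q hw hw1 hQ hQ1
    (fun ρ => max 0 (1 - 1 / ρ)) (A := c * Real.log 2) (B := -c + 1 / (2 * c))
    (C := c + 1 / (2 * c)) (by positivity) ?_
  · refine h.trans (le_of_eq ?_)
    field_simp; ring
  · intro ρ hρ
    -- In terms of `z = ρ ^ (-1/2)`, the quantity `z ^ 2 - 1 - 2 * log z` dominates the Hellinger
    -- term `(z - 1) ^ 2`, and `1 - z ^ 2 = (1 - z) * (1 + z)` is split by the AM-GM inequality with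
    -- weight `c`.
    obtain ⟨z, hz, rfl⟩ : ∃ z : ℝ, 0 < z ∧ ρ = (z ^ 2)⁻¹ :=
      ⟨√ρ⁻¹, by positivity, by rw [Real.sq_sqrt (by positivity), inv_inv]⟩
    have hl : Real.log 2 * Real.logb 2 (z ^ 2)⁻¹ = -(2 * Real.log z) := by
      rw [Real.logb, mul_div_cancel₀ _ (by positivity), Real.log_inv, Real.log_pow]; push_cast; ring
    have hlz := Real.log_le_sub_one_of_pos hz
    show max 0 (1 - 1 / (z ^ 2)⁻¹) ≤ _
    rw [mul_assoc, hl, one_div, div_inv_eq_mul, inv_inv]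
    have h1 : c * (z - 1) ^ 2 + (1 + z ^ 2) / (2 * c) ≤
        c * -(2 * Real.log z) + (-c + 1 / (2 * c)) + (c + 1 / (2 * c)) * z ^ 2 := by
      have e : c * -(2 * Real.log z) + (-c + 1 / (2 * c)) + (c + 1 / (2 * c)) * z ^ 2
        = c * (z ^ 2 - 1 - 2 * Real.log z) + (1 + z ^ 2) / (2 * c) := by ring
      rw [e]
      gcongr
      nlinarith
    refine le_trans (max_le (by positivity) ?_) h1
    have h2 : 1 - z ^ 2 ≤ c * (z - 1) ^ 2 + (1 + z) ^ 2 / (4 * c) := by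
      have : c * (z - 1) ^ 2 + (1 + z) ^ 2 / (4 * c) - (1 - z ^ 2)
          = (2 * c * (z - 1) + (1 + z)) ^ 2 / (4 * c) := by field_simp; ring
      have h3 : 0 ≤ (2 * c * (z - 1) + (1 + z)) ^ 2 / (4 * c) := by positivity
      linarith
    have h3 : (1 + z) ^ 2 / (4 * c) ≤ (1 + z ^ 2) / (2 * c) := by
      rw [div_le_div_iff₀ (by positivity) (by positivity)]
      nlinarith [mul_nonneg hc.le (sq_nonneg (z - 1))]
    linarith

end FiniteInformation

/-! ### From channels of bounded information to bounded functions -/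

section ProductChannel

variable {X Y U : Type*} [Fintype X] [Fintype Y] [Fintype U]

/-- Where the likelihood ratio of a product channel is at most `M`, truncation of the first factor
by `M` times its average has no effect. -/
theorem le_average_of_ratio_le {w : X → ℝ} {a : X → ℝ} {b M : ℝ} {x : X} (hw : ∀ x, 0 ≤ w x)
    (ha : ∀ x, 0 ≤ a x) (hwx : 0 < w x) (hax : 0 < a x) (hb : 0 < b)
    (h : ¬ M < a x * b * (∑ x', w x') / ∑ x', w x' * (a x' * b)) :
    a x ≤ M * ((∑ x', w x' * a x') / ∑ x', w x') := by
  have hS : 0 < ∑ x', w x' * a x' := lt_of_lt_of_le (mul_pos hwx hax)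
    (Finset.single_le_sum (f := fun x' => w x' * a x')
      (fun x' _ => mul_nonneg (hw x') (ha x')) (Finset.mem_univ x))
  have hW : 0 < ∑ x', w x' := lt_of_lt_of_le hwx
    (Finset.single_le_sum (f := w) (fun x' _ => hw x') (Finset.mem_univ x))
  have e : ∑ x', w x' * (a x' * b) = (∑ x', w x' * a x') * b := by
    rw [Finset.sum_mul]; exact Finset.sum_congr rfl fun _ _ => (mul_assoc _ _ _).symm
  rw [e, not_lt, div_le_iff₀ (by positivity)] at h
  rw [← mul_div_assoc, le_div_iff₀ hW]
  nlinarith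

/-- This gives the norm bounds for the truncated kernel. It is only an inequality because the
average is zero when the weights sum to zero. -/
theorem sum_mul_average_le_one {w : Y → ℝ} {a : U → ℝ} {b : Y → U → ℝ}
    (hab : ∀ y, ∑ u, a u * b y u = 1) :
    ∑ u, a u * ((∑ y, w y * b y u) / ∑ y, w y) ≤ 1 := by
  have : ∑ u, a u * ((∑ y, w y * b y u) / ∑ y, w y) = (∑ y, w y) / ∑ y, w y := by
    simp only [← mul_div_assoc, ← Finset.sum_div, Finset.mul_sum]
    rw [Finset.sum_comm]
    congr 1
    refine Finset.sum_congr rfl fun y _ => ?_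
    simp only [mul_left_comm (a _), ← Finset.mul_sum, hab, mul_one]
  rw [this]
  exact div_self_le_one _

/-- A product channel of bounded information whose output `o` is correlated with `F` yields two
bounded functions of `x` and of `y` whose product is correlated with `F`. -/
theorem exists_bounded_of_channelInfo (w F : X → Y → ℝ) (a : X → U → ℝ) (b : Y → U → ℝ)
    (o : U → ℝ) (hw : ∀ x y, 0 ≤ w x y) (hw1 : ∑ x, ∑ y, w x y = 1) (hF : ∀ x y, |F x y| ≤ 1)
    (ha : ∀ x u, 0 ≤ a x u) (hb : ∀ y u, 0 ≤ b y u) (hab : ∀ x y, ∑ u, a x u * b y u = 1)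
    (ho : ∀ u, |o u| ≤ 1) {K : ℝ} (hK : 0 < K)
    (hlarge : 1 / 2 + (channelInfo w (fun x y u => a x u * b y u) + 2) / K +
        (channelInfo (fun y x => w x y) (fun y x u => a x u * b y u) + 2) / K <
      ∑ x, ∑ y, w x y * ∑ u, a x u * b y u * (o u * F x y)) :
    ∃ (g : X → ℝ) (h : Y → ℝ), (∀ x, |g x| ≤ 1) ∧ (∀ y, |h y| ≤ 1) ∧
      1 / (64 * ((2 : ℝ) ^ K) ^ 3) ≤ ∑ x, ∑ y, w x y * F x y * (g x * h y) := by
  classical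
  set M : ℝ := (2 : ℝ) ^ K with hM
  have hMpos : 0 < M := by positivity
  set α : Y → U → ℝ := fun y u => (∑ x', w x' y * a x' u) / ∑ x', w x' y
  set β : X → U → ℝ := fun x u => (∑ y', w x y' * b y' u) / ∑ y', w x y'
  have hα : ∀ y u, 0 ≤ α y u := fun y u => div_nonneg
    (Finset.sum_nonneg fun x _ => mul_nonneg (hw x y) (ha x u))
    (Finset.sum_nonneg fun x _ => hw x y)
  have hβ : ∀ x u, 0 ≤ β x u := fun x u => div_nonneg
    (Finset.sum_nonneg fun y _ => mul_nonneg (hw x y) (hb y u))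
    (Finset.sum_nonneg fun y _ => hw x y)
  have hw1' : ∑ y, ∑ x, w x y = 1 := by rw [Finset.sum_comm]; exact hw1
  have tail1 := tail_le_channelInfo w (fun x y u => a x u * b y u) hw hw1'
    (fun x y u => mul_nonneg (ha x u) (hb y u)) hab hK
  have tail2 := tail_le_channelInfo (fun y x => w x y) (fun y x u => a x u * b y u)
    (fun y x => hw x y) hw1 (fun y x u => mul_nonneg (ha x u) (hb y u)) (fun y x => hab x y) hK
  rw [Finset.sum_comm] at tail1
  have hR : (√M) ^ 6 = M ^ 3 := by
    have := Real.sq_sqrt hMpos.le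
    calc (√M) ^ 6 = ((√M) ^ 2) ^ 3 := by ring
      _ = _ := by rw [this]
  rw [← hR]
  -- Each minimum must compare a function of `x` with a function of `y`: `a` is capped by `M * α`,
  -- which depends on `y`, and `b` by `M * β`, which depends on `x`. The norm bound is `R = √M`.
  refine exists_bounded_of_min_kernel a (fun x u => M * β x u) (fun y u => M * α y u) b o
    (fun x y => w x y * F x y) (by positivity) ha (fun x u => mul_nonneg hMpos.le (hβ x u))
    (fun y u => mul_nonneg hMpos.le (hα y u)) hb ho ?_ ?_ ?_ ?_
  · intro x
    rw [Real.sq_sqrt hMpos.le]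
    have e : ∀ u, a x u * (M * β x u) = M * (a x u * β x u) := fun u => by ring
    simp only [e, ← Finset.mul_sum]
    exact mul_le_of_le_one_right hMpos.le (sum_mul_average_le_one fun y => hab x y)
  · intro y
    rw [Real.sq_sqrt hMpos.le]
    have e : ∀ u, M * α y u * b y u = M * (b y u * α y u) := fun u => by ring
    simp only [e, ← Finset.mul_sum]
    refine mul_le_of_le_one_right hMpos.le (sum_mul_average_le_one fun x => ?_)
    rw [← hab x y]
    exact Finset.sum_congr rfl fun u _ => mul_comm _ _
  · rw [← hw1]
    refine Finset.sum_le_sum fun x _ => Finset.sum_le_sum fun y _ => ?_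
    rw [abs_mul, abs_of_nonneg (hw x y)]
    exact mul_le_of_le_one_right (hw x y) (hF x y)
  · have term : ∀ x y u, w x y * (a x u * b y u * (o u * F x y)) ≤
        w x y * F x y * (o u * (min (a x u) (M * α y u) * min (M * β x u) (b y u))) +
        w x y * (a x u * b y u * (if M < a x u * b y u * (∑ x', w x' y) /
          ∑ x', w x' y * (a x' u * b y u) then (1 : ℝ) else 0)) +
        w x y * (a x u * b y u * (if M < a x u * b y u * (∑ y', w x y') /
          ∑ y', w x y' * (a x u * b y' u) then (1 : ℝ) else 0)) := by
      intro x y u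
      rcases (hw x y).eq_or_lt with h | hwp
      · rw [← h]; simp
      rcases (ha x u).eq_or_lt with h | hap
      · rw [← h, min_eq_left (mul_nonneg hMpos.le (hα y u))]; simp
      rcases (hb y u).eq_or_lt with h | hbp
      · rw [← h, min_eq_right (mul_nonneg hMpos.le (hβ x u))]; simp
      set k := min (a x u) (M * α y u) * min (M * β x u) (b y u) with hk
      have hk0 : 0 ≤ k := mul_nonneg (le_min (ha x u) (mul_nonneg hMpos.le (hα y u)))
        (le_min (mul_nonneg hMpos.le (hβ x u)) (hb y u))
      have hkP : k ≤ a x u * b y u := mul_le_mul (min_le_left _ _) (min_le_right _ _)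
        (le_min (mul_nonneg hMpos.le (hβ x u)) (hb y u)) (ha x u)
      have hFo : o u * F x y ≤ 1 := by
        refine (le_abs_self _).trans ?_
        rw [abs_mul]
        exact mul_le_one₀ (ho u) (abs_nonneg _) (hF x y)
      have hdiff : (a x u * b y u - k) * (o u * F x y) ≤ a x u * b y u * (if M < a x u * b y u *
          (∑ x', w x' y) / ∑ x', w x' y * (a x' u * b y u) then (1 : ℝ) else 0) +
          a x u * b y u * (if M < a x u * b y u * (∑ y', w x y') /
          ∑ y', w x y' * (a x u * b y' u) then (1 : ℝ) else 0) := by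
        have hP : 0 < a x u * b y u := mul_pos hap hbp
        have hle : (a x u * b y u - k) * (o u * F x y) ≤ a x u * b y u - k :=
          mul_le_of_le_one_right (by linarith) hFo
        by_cases h1 : M < a x u * b y u * (∑ x', w x' y) / ∑ x', w x' y * (a x' u * b y u)
        · rw [if_pos h1]
          split_ifs <;> linarith
        by_cases h2 : M < a x u * b y u * (∑ y', w x y') / ∑ y', w x y' * (a x u * b y' u)
        · rw [if_pos h2, if_neg h1]
          linarith
        have h1' : a x u ≤ M * α y u :=
          le_average_of_ratio_le (w := fun x' => w x' y) (a := fun x' => a x' u)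
            (fun x' => hw x' y) (fun x' => ha x' u) hwp hap hbp h1
        have h2' : b y u ≤ M * β x u := by
          refine le_average_of_ratio_le (w := fun y' => w x y') (a := fun y' => b y' u)
            (fun y' => hw x y') (fun y' => hb y' u) hwp hbp hap ?_
          simpa only [mul_comm (b _ u) (a x u)] using h2
        have : k = a x u * b y u := by rw [hk, min_eq_left h1', min_eq_right h2']
        rw [if_neg h1, if_neg h2, this]; simp
      have := mul_le_mul_of_nonneg_left hdiff hwp.le
      linarith
    have hsum := Finset.sum_le_sum fun x (_ : x ∈ (Finset.univ : Finset X)) =>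
      Finset.sum_le_sum fun y (_ : y ∈ (Finset.univ : Finset Y)) =>
      Finset.sum_le_sum fun u (_ : u ∈ (Finset.univ : Finset U)) => term x y u
    simp only [Finset.sum_add_distrib, ← Finset.mul_sum] at hsum
    linarith

/-- A product channel of small information whose output `o` is correlated with `F` yields a
bounded function of `x` correlated with `F`. -/
theorem exists_bounded_left_of_channelInfo (w F : X → Y → ℝ) (Q : X → Y → U → ℝ)
    (o : U → ℝ) (hw : ∀ x y, 0 ≤ w x y) (hw1 : ∑ x, ∑ y, w x y = 1) (hF : ∀ x y, |F x y| ≤ 1)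
    (hQ : ∀ x y u, 0 ≤ Q x y u) (hQ1 : ∀ x y, ∑ u, Q x y u = 1)
    (ho : ∀ u, |o u| ≤ 1) {c : ℝ} (hc : 0 < c) :
    ∃ g : X → ℝ, (∀ x, |g x| ≤ 1) ∧
      ∑ x, ∑ y, w x y * ∑ u, Q x y u * (o u * F x y) -
        2 * (c * Real.log 2 * channelInfo (fun y x => w x y) (fun y x u => Q x y u) + 1 / c)
        ≤ ∑ x, ∑ y, w x y * F x y * g x := by
  classical
  set q : X → U → ℝ := fun x u => (∑ y', w x y' * Q x y' u) / ∑ y', w x y'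
  have hS0 : ∀ x u, 0 ≤ ∑ y', w x y' * Q x y' u := fun x u =>
    Finset.sum_nonneg fun y _ => mul_nonneg (hw x y) (hQ x y u)
  have hW0 : ∀ x, 0 ≤ ∑ y', w x y' := fun x => Finset.sum_nonneg fun y _ => hw x y
  have hq : ∀ x u, 0 ≤ q x u := fun x u => div_nonneg (hS0 x u) (hW0 x)
  have hqsum : ∀ x, ∑ u, q x u = (∑ y', w x y') / ∑ y', w x y' := by
    intro x
    simp only [q, ← Finset.sum_div]
    rw [Finset.sum_comm]
    simp only [← Finset.mul_sum, hQ1, mul_one]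
  have hvar := variation_le_channelInfo (fun y x => w x y) (fun y x u => Q x y u)
    (fun y x => hw x y) hw1 (fun y x u => hQ x y u) (fun y x => hQ1 x y) hc
  refine ⟨fun x => ∑ u, q x u * o u, fun x => ?_, ?_⟩
  · refine (Finset.abs_sum_le_sum_abs _ _).trans ?_
    refine le_trans (Finset.sum_le_sum fun u _ => ?_) ((hqsum x).le.trans (div_self_le_one _))
    rw [abs_mul, abs_of_nonneg (hq x u)]
    exact mul_le_of_le_one_right (hq x u) (ho u)
  -- Adding 1 to `o u * F x y` puts it in `[0, 2]`, so only the positive part of `Q x y u - q x u`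
  -- matters. The added terms are harmless after summation: `w * Q` sums to one and `w * q` to at
  -- most one.
  · have term : ∀ x y u, w x y * (Q x y u * (o u * F x y)) + w x y * Q x y u - w x y * q x u ≤
        w x y * F x y * (q x u * o u) + 2 * (w x y * (Q x y u * max 0
          (1 - 1 / (Q x y u * (∑ y', w x y') / ∑ y', w x y' * Q x y' u)))) := by
      intro x y u
      rcases (hw x y).eq_or_lt with h | hwp
      · rw [← h]; simp
      have hFo := abs_le.1 (show |o u * F x y| ≤ 1 by
        rw [abs_mul]; exact mul_le_one₀ (ho u) (abs_nonneg _) (hF x y))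
      rcases (hQ x y u).eq_or_lt with h | hQp
      · rw [← h]
        have := mul_nonneg (mul_nonneg (hw x y) (hq x u)) (neg_le_iff_add_nonneg.1 hFo.1)
        simp only [zero_mul, mul_zero]
        linarith
      have hSp : 0 < ∑ y', w x y' * Q x y' u := lt_of_lt_of_le (mul_pos hwp hQp)
        (Finset.single_le_sum (f := fun y' => w x y' * Q x y' u)
          (fun y' _ => mul_nonneg (hw x y') (hQ x y' u)) (Finset.mem_univ y))
      have hWp : 0 < ∑ y', w x y' := lt_of_lt_of_le hwp
        (Finset.single_le_sum (f := fun y' => w x y') (fun y' _ => hw x y') (Finset.mem_univ y))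
      have e : Q x y u * (1 - 1 / (Q x y u * (∑ y', w x y') / ∑ y', w x y' * Q x y' u))
          = Q x y u - q x u := by
        simp only [q]; field_simp
      have h1 : Q x y u - q x u ≤ Q x y u * max 0
          (1 - 1 / (Q x y u * (∑ y', w x y') / ∑ y', w x y' * Q x y' u)) := by
        rw [← e]; gcongr; exact le_max_right _ _
      have h0 : 0 ≤ Q x y u * max 0
          (1 - 1 / (Q x y u * (∑ y', w x y') / ∑ y', w x y' * Q x y' u)) :=
        mul_nonneg hQp.le (le_max_left _ _)
      have h2 : (Q x y u - q x u) * (1 + o u * F x y) ≤ 2 * (Q x y u * max 0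
          (1 - 1 / (Q x y u * (∑ y', w x y') / ∑ y', w x y' * Q x y' u))) := by
        nlinarith
      have := mul_le_mul_of_nonneg_left h2 hwp.le
      linarith
    have hsum := Finset.sum_le_sum fun x (_ : x ∈ (Finset.univ : Finset X)) =>
      Finset.sum_le_sum fun y (_ : y ∈ (Finset.univ : Finset Y)) =>
      Finset.sum_le_sum fun u (_ : u ∈ (Finset.univ : Finset U)) => term x y u
    simp only [Finset.sum_sub_distrib, Finset.sum_add_distrib, ← Finset.mul_sum, hQ1, mul_one,
      hw1] at hsum
    have h3 : ∑ x, ∑ y, w x y * ∑ u, q x u ≤ 1 := by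
      rw [← hw1]
      refine Finset.sum_le_sum fun x _ => Finset.sum_le_sum fun y _ => ?_
      rw [hqsum]
      exact mul_le_of_le_one_right (hw x y) (div_self_le_one _)
    linarith

/-- Optimising over bounded functions, one may take signs. -/
theorem exists_sign_ge (c g : X → ℝ) (hg : ∀ x, |g x| ≤ 1) :
    ∃ s : X → Bool, ∑ x, c x * g x ≤ ∑ x, c x * (if s x then 1 else -1) := by
  classical
  refine ⟨fun x => decide (0 ≤ c x), Finset.sum_le_sum fun x _ => ?_⟩
  have := abs_le.1 (hg x)
  by_cases h : 0 ≤ c x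
  · simp only [h, decide_true, if_true]; nlinarith
  · simp only [h, decide_false]
    push Not at h
    simp only [Bool.false_eq_true, if_false]
    nlinarith

end ProductChannel

/-! ### Probabilities of events under `PMF` constructions -/

section Prob

variable {Ω α : Type*}

theorem toOuterMeasure_le_one (p : PMF Ω) (E : Set Ω) : p.toOuterMeasure E ≤ 1 := by
  rw [PMF.toOuterMeasure_apply, ← p.tsum_coe]
  exact ENNReal.tsum_le_tsum fun a => Set.indicator_le_self _ _ _

theorem toOuterMeasure_ne_top (p : PMF Ω) (E : Set Ω) : p.toOuterMeasure E ≠ ⊤ :=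
  ((toOuterMeasure_le_one p E).trans_lt ENNReal.one_lt_top).ne

theorem prob_nonneg (p : PMF Ω) (E : Set Ω) : 0 ≤ prob p E := ENNReal.toReal_nonneg

theorem prob_le_one (p : PMF Ω) (E : Set Ω) : prob p E ≤ 1 := by
  rw [prob, ← ENNReal.toReal_one]
  exact ENNReal.toReal_mono ENNReal.one_ne_top (toOuterMeasure_le_one p E)

theorem prob_mono (p : PMF Ω) {E F : Set Ω} (h : E ⊆ F) : prob p E ≤ prob p F :=
  ENNReal.toReal_mono (toOuterMeasure_ne_top p F) (p.toOuterMeasure.mono h)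

theorem prob_univ (p : PMF Ω) : prob p Set.univ = 1 := by
  rw [prob, PMF.toOuterMeasure_apply]
  simp [p.tsum_coe]

theorem hasSum_toReal (p : PMF Ω) : HasSum (fun a => (p a).toReal) 1 := by
  have h := ENNReal.hasSum_toReal (f := fun a => p a) (by rw [p.tsum_coe]; exact ENNReal.one_ne_top)
  rwa [← ENNReal.tsum_toReal_eq (fun a => p.apply_ne_top a), p.tsum_coe, ENNReal.toReal_one] at h

theorem hasSum_prob_bind (p : PMF α) (f : α → PMF Ω) (E : Set Ω) :
    HasSum (fun a => (p a).toReal * prob (f a) E) (prob (p.bind f) E) := by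
  have hne : (p.bind f).toOuterMeasure E ≠ ⊤ := toOuterMeasure_ne_top _ _
  rw [PMF.toOuterMeasure_bind_apply] at hne
  have h := ENNReal.hasSum_toReal hne
  rw [prob, PMF.toOuterMeasure_bind_apply, ENNReal.tsum_toReal_eq fun a =>
    ENNReal.mul_ne_top (p.apply_ne_top a) (toOuterMeasure_ne_top _ _)]
  simpa only [ENNReal.toReal_mul, prob] using h

theorem prob_bind [Fintype α] (p : PMF α) (f : α → PMF Ω) (E : Set Ω) :
    prob (p.bind f) E = ∑ a, (p a).toReal * prob (f a) E :=
  (hasSum_prob_bind p f E).unique (hasSum_fintype _)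

theorem prob_map (p : PMF α) (f : α → Ω) (E : Set Ω) : prob (p.map f) E = prob p (f ⁻¹' E) := by
  rw [prob, PMF.toOuterMeasure_map_apply, prob]

theorem prob_pure (a : Ω) (E : Set Ω) [Decidable (a ∈ E)] :
    prob (PMF.pure a) E = if a ∈ E then 1 else 0 := by
  rw [prob, PMF.toOuterMeasure_pure_apply]
  by_cases h : a ∈ E <;> simp [h]

theorem prob_eq_sum_inter [Fintype α] (p : PMF Ω) (A : Ω → α) (E : Set Ω) :
    prob p E = ∑ a, prob p ({ω | A ω = a} ∩ E) := by
  classical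
  simp only [prob]
  rw [← ENNReal.toReal_sum fun a _ => toOuterMeasure_ne_top _ _]
  congr 1
  simp only [PMF.toOuterMeasure_apply]
  rw [← Summable.tsum_finsetSum fun a _ => ENNReal.summable]
  refine tsum_congr fun ω => ?_
  rw [Finset.sum_eq_single (A ω)]
  · by_cases h : ω ∈ E <;> simp [h]
  · intro a _ ha
    rw [Set.indicator_of_notMem]
    exact fun h => ha h.1.symm
  · simp

end Prob

/-! ### Conditional entropy in terms of joint probabilities -/

section Entropy

variable {Ω α β : Type*} [Fintype α]

theorem prob_mul_entropyGiven (p : PMF Ω) (A : Ω → α) (E : Set Ω) :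
    prob p E * entropyGiven p A E = ∑ a, prob p ({ω | A ω = a} ∩ E) *
      Real.logb 2 (prob p E / prob p ({ω | A ω = a} ∩ E)) := by
  rw [entropyGiven, tsum_fintype, Finset.mul_sum]
  refine Finset.sum_congr rfl fun a _ => ?_
  have hle : prob p ({ω | A ω = a} ∩ E) ≤ prob p E := prob_mono p Set.inter_subset_right
  rcases (prob_nonneg p E).eq_or_lt with h | h
  · have h0 : prob p ({ω | A ω = a} ∩ E) = 0 :=
      le_antisymm (hle.trans h.symm.le) (prob_nonneg _ _)
    rw [← h, h0]; simp
  · rw [one_div_div, ← mul_assoc, mul_div_cancel₀ _ h.ne']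

theorem condEntropy_eq (p : PMF Ω) (A : Ω → α) (B : Ω → β) :
    condEntropy p A B = ∑' b, ∑ a, prob p ({ω | A ω = a} ∩ {ω | B ω = b}) *
      Real.logb 2 ((∑ a', prob p ({ω | A ω = a'} ∩ {ω | B ω = b})) /
        prob p ({ω | A ω = a} ∩ {ω | B ω = b})) := by
  rw [condEntropy]
  refine tsum_congr fun b => ?_
  rw [prob_mul_entropyGiven, ← prob_eq_sum_inter]

theorem mul_logb_div_nonneg {s t : ℝ} (hs : 0 ≤ s) (hst : s ≤ t) : 0 ≤ s * Real.logb 2 (t / s) := by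
  rcases hs.eq_or_lt with h | h
  · rw [← h]; simp
  · exact mul_nonneg hs (Real.logb_nonneg (by norm_num) ((one_le_div h).2 hst))

/-- A crude bound, linear in `t`, which yields a bound on the conditional entropies uniform in the
public coin and hence summability over the coin. -/
theorem mul_logb_div_le {s t : ℝ} (hs : 0 ≤ s) (hst : s ≤ t) : s * Real.logb 2 (t / s) ≤ 2 * t := by
  rcases hs.eq_or_lt with h | h
  · rw [← h]; simp; linarith
  · have ht : 0 < t := h.trans_le hst
    have h1 := Real.log_le_sub_one_of_pos (div_pos ht h)
    have h2 : (1 : ℝ) / 2 ≤ Real.log 2 := by have := Real.log_two_gt_d9; linarith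
    rw [Real.logb, ← mul_div_assoc, div_le_iff₀ (by linarith)]
    have h3 : s * Real.log (t / s) ≤ s * (t / s) := by gcongr; linarith
    rw [mul_div_cancel₀ _ h.ne'] at h3
    nlinarith

/-- The conditional information of a transcript consisting of a discrete public coin and a message
is the average over the coin of the informations of the channels that it selects. -/
theorem hasSum_channelInfo {γ ρ τ : Type*} [Fintype γ] {U : ρ → Type*} [∀ r, Fintype (U r)]
    (p : PMF Ω) (A : Ω → α) (C : Ω → γ) (T : Ω → ρ × τ) (coin : ρ → ℝ) (w : α → γ → ℝ)
    (msg : ∀ r, U r → τ) (Q : ∀ r, α → γ → U r → ℝ)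
    (hcoin : ∀ r, 0 ≤ coin r) (hcoin1 : HasSum coin 1)
    (hw : ∀ a c, 0 ≤ w a c) (hw1 : ∑ c, ∑ a, w a c = 1)
    (hmsg : ∀ r, Function.Injective (msg r))
    (hQ : ∀ r a c u, 0 ≤ Q r a c u) (hQ1 : ∀ r a c, ∑ u, Q r a c u = 1)
    (hAC : ∀ a c, prob p ({ω | A ω = a} ∩ {ω | C ω = c}) = w a c)
    (hjoint : ∀ a c r u, prob p ({ω | A ω = a} ∩ {ω | (T ω, C ω) = ((r, msg r u), c)})
      = coin r * (w a c * Q r a c u))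
    (hjoint0 : ∀ a c r m, m ∉ Set.range (msg r) →
      prob p ({ω | A ω = a} ∩ {ω | (T ω, C ω) = ((r, m), c)}) = 0) :
    HasSum (fun r => coin r * channelInfo w (Q r)) (condMutualInfo p A T C) := by
  classical
  set H : ℝ := ∑ c, ∑ a, w a c * Real.logb 2 ((∑ a', w a' c) / w a c) with hH
  set G : ∀ r, U r → γ → ℝ := fun r u c => ∑ a, w a c * Q r a c u *
    Real.logb 2 ((∑ a', w a' c * Q r a' c u) / (w a c * Q r a c u)) with hG
  have hwQ : ∀ r a c u, 0 ≤ w a c * Q r a c u := fun r a c u => mul_nonneg (hw a c) (hQ r a c u)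
  have hwQle : ∀ r a c u, w a c * Q r a c u ≤ ∑ a', w a' c * Q r a' c u := fun r a c u =>
    Finset.single_le_sum (f := fun a' => w a' c * Q r a' c u) (fun a' _ => hwQ r a' c u)
      (Finset.mem_univ a)
  have hG0 : ∀ r u c, 0 ≤ G r u c := fun r u c =>
    Finset.sum_nonneg fun a _ => mul_logb_div_nonneg (hwQ r a c u) (hwQle r a c u)
  have hGle : ∀ r, ∑ u, ∑ c, G r u c ≤ 2 * Fintype.card α := by
    intro r
    have h1 : ∀ u c, G r u c ≤ 2 * Fintype.card α * ∑ a, w a c * Q r a c u := by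
      intro u c
      refine (Finset.sum_le_sum fun a _ => mul_logb_div_le (hwQ r a c u) (hwQle r a c u)).trans ?_
      rw [Finset.sum_const, Finset.card_univ, nsmul_eq_mul]
      exact le_of_eq (by ring)
    refine (Finset.sum_le_sum fun u _ => Finset.sum_le_sum fun c _ => h1 u c).trans (le_of_eq ?_)
    simp only [← Finset.mul_sum]
    have : ∑ u, ∑ c, ∑ a, w a c * Q r a c u = 1 := by
      rw [Finset.sum_comm, ← hw1]
      refine Finset.sum_congr rfl fun c _ => ?_
      rw [Finset.sum_comm]
      simp only [← Finset.mul_sum, hQ1, mul_one]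
    rw [this, mul_one]
  have hinfo : ∀ r, channelInfo w (Q r) = H - ∑ u, ∑ c, G r u c := by
    intro r
    have e1 : H = ∑ c, ∑ a, ∑ u, w a c * Q r a c u * Real.logb 2 ((∑ a', w a' c) / w a c) := by
      refine Finset.sum_congr rfl fun c _ => Finset.sum_congr rfl fun a _ => ?_
      rw [← Finset.sum_mul, ← Finset.mul_sum, hQ1, mul_one]
    have e2 : ∑ u, ∑ c, G r u c = ∑ c, ∑ a, ∑ u, w a c * Q r a c u *
        Real.logb 2 ((∑ a', w a' c * Q r a' c u) / (w a c * Q r a c u)) := by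
      rw [Finset.sum_comm]
      exact Finset.sum_congr rfl fun c _ => Finset.sum_comm
    rw [e1, e2, ← Finset.sum_sub_distrib]
    refine Finset.sum_congr rfl fun c _ => ?_
    rw [← Finset.sum_sub_distrib]
    refine Finset.sum_congr rfl fun a _ => ?_
    rw [← Finset.sum_sub_distrib, Finset.mul_sum]
    refine Finset.sum_congr rfl fun u _ => ?_
    rcases (hw a c).eq_or_lt with h | hwp
    · rw [← h]; simp
    rcases (hQ r a c u).eq_or_lt with h | hQp
    · rw [← h]; simp
    have hS : 0 < ∑ a', w a' c * Q r a' c u := (mul_pos hwp hQp).trans_le (hwQle r a c u)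
    have hW : 0 < ∑ a', w a' c := hwp.trans_le
      (Finset.single_le_sum (f := fun a' => w a' c) (fun a' _ => hw a' c) (Finset.mem_univ a))
    rw [← mul_sub, ← Real.logb_div (by positivity) (by positivity), ← mul_assoc]
    congr 2
    field_simp
  have h1 : condEntropy p A C = H := by
    rw [condEntropy_eq, tsum_fintype]
    simp only [hAC, hH]
  have h2 : HasSum (fun r => coin r * ∑ u, ∑ c, G r u c)
      (condEntropy p A fun ω => (T ω, C ω)) := by
    set f : (ρ × τ) × γ → ℝ := fun b =>
      ∑ a, prob p ({ω | A ω = a} ∩ {ω | (T ω, C ω) = b}) *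
      Real.logb 2 ((∑ a', prob p ({ω | A ω = a'} ∩ {ω | (T ω, C ω) = b})) /
        prob p ({ω | A ω = a} ∩ {ω | (T ω, C ω) = b})) with hf
    -- The probability of the coin cancels inside the logarithm, leaving it only as a weight.
    have hf1 : ∀ r u c, f ((r, msg r u), c) = coin r * G r u c := by
      intro r u c
      simp only [hf, hjoint, hG, ← Finset.mul_sum]
      refine Eq.trans (Finset.sum_congr rfl fun a _ => ?_) (Finset.mul_sum _ _ _).symm
      rcases (hcoin r).eq_or_lt with h | h
      · rw [← h]; simp
      · rw [mul_div_mul_left _ _ h.ne', mul_assoc]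
    have hf0 : ∀ r m c, m ∉ Set.range (msg r) → f ((r, m), c) = 0 := by
      intro r m c hm
      simp only [hf]
      refine Finset.sum_eq_zero fun a _ => ?_
      rw [hjoint0 a c r m hm, zero_mul]
    -- The type of messages may be infinite, but for a fixed coin only the finite, injective image
    -- of the leaves contributes.
    have hfiber : ∀ r, HasSum (fun mc : τ × γ => f ((r, mc.1), mc.2))
        (coin r * ∑ u, ∑ c, G r u c) := by
      intro r
      have hinj : Function.Injective (fun uc : U r × γ => (msg r uc.1, uc.2)) := by
        intro a b hab
        simp only [Prod.mk.injEq] at hab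
        exact Prod.ext (hmsg r hab.1) hab.2
      rw [← hinj.hasSum_iff]
      · have h := hasSum_fintype (fun uc : U r × γ => f ((r, msg r uc.1), uc.2))
        have e : ∑ uc : U r × γ, f ((r, msg r uc.1), uc.2) = coin r * ∑ u, ∑ c, G r u c := by
          rw [Fintype.sum_prod_type]
          simp only [hf1, ← Finset.mul_sum]
        rwa [e] at h
      · rintro ⟨m, c⟩ hmc
        refine hf0 r m c fun ⟨u, hu⟩ => hmc ⟨(u, c), by simp [hu]⟩
    have hfnn : ∀ b, 0 ≤ f b := by
      rintro ⟨⟨r, m⟩, c⟩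
      by_cases hm : m ∈ Set.range (msg r)
      · obtain ⟨u, rfl⟩ := hm
        rw [hf1]; exact mul_nonneg (hcoin r) (hG0 r u c)
      · rw [hf0 r m c hm]
    have hsummable : Summable fun r => coin r * ∑ u, ∑ c, G r u c := by
      refine Summable.of_nonneg_of_le (fun r => mul_nonneg (hcoin r)
        (Finset.sum_nonneg fun u _ => Finset.sum_nonneg fun c _ => hG0 r u c))
        (fun r => mul_le_mul_of_nonneg_left (hGle r) (hcoin r)) (hcoin1.summable.mul_right _)
    have hfs : Summable fun x : ρ × (τ × γ) => f ((x.1, x.2.1), x.2.2) := by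
      rw [summable_prod_of_nonneg (fun x => hfnn _)]
      refine ⟨fun r => (hfiber r).summable, ?_⟩
      simpa only [(hfiber _).tsum_eq] using hsummable
    rw [condEntropy_eq]
    change HasSum _ (∑' b, f b)
    have e : ∑' b, f b = ∑' x : ρ × (τ × γ), f ((x.1, x.2.1), x.2.2) :=
      ((Equiv.prodAssoc ρ τ γ).symm.tsum_eq f).symm
    rw [e, hfs.tsum_prod]
    simp only [(hfiber _).tsum_eq]
    exact hsummable.hasSum
  rw [condMutualInfo, h1]
  have h3 := (hcoin1.mul_right H).sub h2
  rw [one_mul] at h3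
  simpa only [hinfo, mul_sub] using h3

end Entropy

/-! ### Protocol trees as product channels -/

/-- Gibbs' inequality: `log ρ ≥ 1 - 1 / ρ`, inserted in the general comparison with `φ = 0`. -/
theorem channelInfo_nonneg {X Y U : Type*} [Fintype X] [Fintype Y] [Fintype U] (w : X → Y → ℝ)
    (Q : X → Y → U → ℝ) (hw : ∀ x y, 0 ≤ w x y) (hw1 : ∑ y, ∑ x, w x y = 1)
    (hQ : ∀ x y u, 0 ≤ Q x y u) (hQ1 : ∀ x y, ∑ u, Q x y u = 1) : 0 ≤ channelInfo w Q := by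
  have hlog : 0 < Real.log 2 := Real.log_pos (by norm_num)
  have h := sum_mul_le_channelInfo w Q hw hw1 hQ hQ1 (fun _ => 0) (A := Real.log 2) (B := -1)
    (C := 1) zero_le_one fun ρ hρ => by
      have h1 := Real.log_le_sub_one_of_pos (inv_pos.2 hρ)
      rw [Real.log_inv] at h1
      rw [Real.logb, mul_div_cancel₀ _ hlog.ne', one_div]
      linarith
  simp only [mul_zero, Finset.sum_const_zero] at h
  have h' : 0 ≤ Real.log 2 * channelInfo w Q := by linarith
  exact nonneg_of_mul_nonneg_right h' hlog

section Trees

variable {X Y : Type*}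

open Classical in
/-- The leaves of a protocol tree are reached with probabilities that are products of a function
of `x` and a function of `y`, and are determined by the messages. -/
theorem exists_leaves {P : Player} (T : ProtocolTree X Y P) :
    ∃ (U : Type) (_ : Fintype U) (a : X → U → ℝ) (b : Y → U → ℝ) (o : U → Bool)
      (msg : U → List (List Bool)), Function.Injective msg ∧ (∀ x u, 0 ≤ a x u) ∧
      (∀ y u, 0 ≤ b y u) ∧ ∀ x y E, prob (T.run x y) E =
        ∑ u, a x u * b y u * if (msg u, o u) ∈ E then 1 else 0 := by
  induction T with
  | leaf out =>
    refine ⟨Unit, inferInstance, fun _ _ => 1, fun _ _ => 1, fun _ => out, fun _ => [],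
      fun _ _ _ => rfl, fun _ _ => zero_le_one, fun _ _ => zero_le_one, fun x y E => ?_⟩
    rw [ProtocolTree.run, prob_pure]
    simp
  | @nodeA k label prefixFree move child ih =>
    choose U instU a b o msg hinj ha hb hrun using ih
    refine ⟨Σ i, U i, inferInstance, fun x u => (move x u.1).toReal * a u.1 x u.2,
      fun y u => b u.1 y u.2, fun u => o u.1 u.2, fun u => label u.1 :: msg u.1 u.2,
      ?_, fun x u => mul_nonneg ENNReal.toReal_nonneg (ha _ _ _), fun y u => hb _ _ _,
      fun x y E => ?_⟩
    · rintro ⟨i, u⟩ ⟨j, v⟩ h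
      simp only [List.cons.injEq] at h
      -- Equal labels are prefixes of each other, so prefix-freeness makes the first message
      -- determine the child.
      obtain rfl := prefixFree i j (h.1 ▸ List.prefix_rfl)
      rw [hinj i h.2]
    · rw [ProtocolTree.run, prob_bind, Fintype.sum_sigma]
      refine Finset.sum_congr rfl fun i _ => ?_
      rw [prob_map, hrun, Finset.mul_sum]
      refine Finset.sum_congr rfl fun u _ => ?_
      simp only [Set.mem_preimage]
      ring
  | @nodeB k label prefixFree move child ih =>
    choose U instU a b o msg hinj ha hb hrun using ih
    refine ⟨Σ i, U i, inferInstance, fun x u => a u.1 x u.2,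
      fun y u => (move y u.1).toReal * b u.1 y u.2, fun u => o u.1 u.2,
      fun u => label u.1 :: msg u.1 u.2,
      ?_, fun x u => ha _ _ _, fun y u => mul_nonneg ENNReal.toReal_nonneg (hb _ _ _),
      fun x y E => ?_⟩
    · rintro ⟨i, u⟩ ⟨j, v⟩ h
      simp only [List.cons.injEq] at h
      obtain rfl := prefixFree i j (h.1 ▸ List.prefix_rfl)
      rw [hinj i h.2]
    · rw [ProtocolTree.run, prob_bind, Fintype.sum_sigma]
      refine Finset.sum_congr rfl fun i _ => ?_
      rw [prob_map, hrun, Finset.mul_sum]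
      refine Finset.sum_congr rfl fun u _ => ?_
      simp only [Set.mem_preimage]
      ring

/-! ### Simple protocols -/

theorem commCost_pure_le {P : Player} (T : ProtocolTree X Y P) {n : ℕ} (h : T.cost ≤ n) :
    Protocol.commCost (PMF.pure ⟨P, T⟩) ≤ n := by
  refine iSup₂_le fun r hr => ?_
  rw [PMF.support_pure, Set.mem_singleton_iff] at hr
  subst hr
  exact_mod_cast h

/-- The one-bit labels. -/
def bitLabel (i : Fin 2) : List Bool := [decide (i = 1)]

theorem bitLabel_prefixFree (i j : Fin 2) (h : bitLabel i <+: bitLabel j) : i = j := by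
  revert i j; decide

/-- The first player sends the bit `s x`, which is the output. -/
noncomputable def oneBitTree (s : X → Bool) : ProtocolTree X Y Player.A :=
  .nodeA bitLabel bitLabel_prefixFree (fun x => PMF.pure (if s x then 1 else 0))
    fun i => .leaf (decide (i = 1))

/-- The players send the bits `s x` and `t y`; the output tells whether they are equal. -/
noncomputable def twoBitTree (s : X → Bool) (t : Y → Bool) : ProtocolTree X Y Player.A :=
  .nodeA bitLabel bitLabel_prefixFree (fun x => PMF.pure (if s x then 1 else 0))
    fun i => .nodeB bitLabel bitLabel_prefixFree (fun y => PMF.pure (if t y then 1 else 0))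
      fun j => .leaf (decide (i = j))

theorem oneBitTree_run (s : X → Bool) (x : X) (y : Y) :
    ∃ m, (oneBitTree s : ProtocolTree X Y _).run x y = PMF.pure (m, s x) := by
  cases h : s x <;>
    exact ⟨_, by simp [oneBitTree, ProtocolTree.run, h, PMF.pure_bind, PMF.pure_map]; rfl⟩

theorem twoBitTree_run (s : X → Bool) (t : Y → Bool) (x : X) (y : Y) :
    ∃ m, (twoBitTree s t).run x y = PMF.pure (m, s x == t y) := by
  cases h : s x <;> cases h' : t y <;>
    exact ⟨_, by simp [twoBitTree, ProtocolTree.run, h, h', PMF.pure_bind, PMF.pure_map]; rfl⟩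

theorem oneBitTree_cost (s : X → Bool) : (oneBitTree s : ProtocolTree X Y _).cost ≤ 1 := by
  simp [oneBitTree, ProtocolTree.cost, bitLabel]

theorem twoBitTree_cost (s : X → Bool) (t : Y → Bool) : (twoBitTree s t).cost ≤ 2 := by
  simp [twoBitTree, ProtocolTree.cost, bitLabel, Finset.sup_const]

/-- Prefix-free unary labels. -/
def unaryLabel {k : ℕ} (i : Fin k) : List Bool := List.replicate i false ++ [true]

theorem unaryLabel_prefixFree {k : ℕ} (i j : Fin k) (h : unaryLabel i <+: unaryLabel j) :
    i = j := by
  have key : ∀ m n : ℕ, List.replicate m false ++ [true] <+: List.replicate n false ++ [true] →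
      m = n := by
    intro m
    induction m with
    | zero =>
      intro n h
      cases n with
      | zero => rfl
      | succ n => simp [List.replicate_succ] at h
    | succ m ih =>
      intro n h
      cases n with
      | zero => simp [List.replicate_succ] at h
      | succ n =>
        simp only [List.replicate_succ, List.cons_append, List.cons_prefix_cons, true_and] at h
        rw [ih n h]
  exact Fin.ext (key _ _ h)

/-! ### Averaging over the public coin -/

theorem prob_empty {Ω : Type*} (p : PMF Ω) : prob p ∅ = 0 := by
  simp [prob]

/-- The sign `±1` encoded by a bit. -/
def sign (c : Bool) : ℝ := if c then 1 else -1

theorem abs_sign (c : Bool) : |sign c| = 1 := by cases c <;> simp [sign]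

theorem sign_mul_sign (c d : Bool) : sign c * sign d = 1 - 2 * if c ≠ d then 1 else 0 := by
  cases c <;> cases d <;> norm_num [sign]

variable [Fintype X] [Fintype Y]

/-- The probability of an event in an execution, as an average over the public coin. -/
theorem hasSum_prob_execution (π : Protocol X Y) (μ : PMF (X × Y)) (E : Set (Execution X Y)) :
    HasSum (fun r => (π r).toReal * ∑ x, ∑ y, (μ (x, y)).toReal *
      prob (r.tree.run x y) {z | (⟨x, y, (r, z.1), z.2⟩ : Execution X Y) ∈ E})
      (prob (π.execution μ) E) := by
  have h := hasSum_prob_bind π (fun r => μ.bind fun xy => (r.tree.run xy.1 xy.2).map fun z =>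
    (⟨xy.1, xy.2, (r, z.1), z.2⟩ : Execution X Y)) E
  rw [Protocol.execution, PMF.bind_comm]
  simpa only [prob_bind, Fintype.sum_prod_type, prob_map, Set.preimage] using h

theorem sum_toReal_eq_one (μ : PMF (X × Y)) : ∑ x, ∑ y, (μ (x, y)).toReal = 1 := by
  rw [← Fintype.sum_prod_type (f := fun xy => (μ xy).toReal)]
  exact (hasSum_fintype _).unique (hasSum_toReal μ)

theorem prob_execution_inputs (π : Protocol X Y) (μ : PMF (X × Y)) (x : X) (y : Y) :
    prob (π.execution μ) {ω | ω.x = x ∧ ω.y = y} = (μ (x, y)).toReal := by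
  classical
  have h := hasSum_prob_execution π μ {ω | ω.x = x ∧ ω.y = y}
  have e : ∀ r : PrivateProtocol X Y, (π r).toReal * ∑ x', ∑ y', (μ (x', y')).toReal *
      prob (r.tree.run x' y') {z | (⟨x', y', (r, z.1), z.2⟩ : Execution X Y) ∈
        {ω : Execution X Y | ω.x = x ∧ ω.y = y}} = (π r).toReal * (μ (x, y)).toReal := by
    intro r
    congr 1
    rw [Finset.sum_eq_single x, Finset.sum_eq_single y]
    · simp [prob_univ]
    · intro y' _ hy'; simp [hy', prob_empty]
    · simp
    · intro x' _ hx'; simp [hx', prob_empty]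
    · simp
  simp only [e] at h
  have h' := (hasSum_toReal π).mul_right (μ (x, y)).toReal
  rw [one_mul] at h'
  exact h.unique h'

theorem prob_execution_transcript (π : Protocol X Y) (μ : PMF (X × Y)) (x : X) (y : Y)
    (r : PrivateProtocol X Y) (m : List (List Bool)) :
    prob (π.execution μ) {ω | ω.x = x ∧ ω.y = y ∧ ω.transcript = (r, m)}
      = (π r).toReal * ((μ (x, y)).toReal * prob (r.tree.run x y) {z | z.1 = m}) := by
  classical
  have h := hasSum_prob_execution π μ {ω | ω.x = x ∧ ω.y = y ∧ ω.transcript = (r, m)}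
  have h' := h.unique (hasSum_single r fun r' hr' => ?_)
  · rw [h']
    congr 1
    rw [Finset.sum_eq_single x, Finset.sum_eq_single y]
    · simp
    · intro y' _ hy'; simp [hy', prob_empty]
    · simp
    · intro x' _ hx'; simp [hx', prob_empty]
    · simp
  · simp [hr', prob_empty]

/-- Fixing the public coin: some private coins protocol in the support does as well as the average
with respect to a linear trade-off between error and information. -/
theorem exists_channel_of_protocol (π : Protocol X Y) (f : X → Y → Bool) (μ : PMF (X × Y))
    (t : ℝ) :
    ∃ (U : Type) (_ : Fintype U) (a : X → U → ℝ) (b : Y → U → ℝ) (o : U → Bool),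
      (∀ x u, 0 ≤ a x u) ∧ (∀ y u, 0 ≤ b y u) ∧ (∀ x y, ∑ u, a x u * b y u = 1) ∧
      1 - 2 * π.errorProb f μ - t * π.infoCost μ ≤
        ∑ x, ∑ y, (μ (x, y)).toReal * ∑ u, a x u * b y u * (sign (o u) * sign (f x y)) -
        t * (channelInfo (fun x y => (μ (x, y)).toReal) (fun x y u => a x u * b y u) +
          channelInfo (fun y x => (μ (x, y)).toReal) (fun y x u => a x u * b y u)) := by
  classical
  choose U instU a b o msg hinj ha hb hrun using
    fun r : PrivateProtocol X Y => exists_leaves r.tree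
  have hab : ∀ r x y, ∑ u, a r x u * b r y u = 1 := by
    intro r x y
    have := hrun r x y Set.univ
    simpa [prob_univ] using this.symm
  have hmsg : ∀ r x y u, prob (r.tree.run x y) {z | z.1 = msg r u} = a r x u * b r y u := by
    intro r x y u
    rw [hrun, Finset.sum_eq_single u]
    · simp
    · intro v _ hv
      simp [(hinj r).ne hv]
    · simp
  have hmsg0 : ∀ r x y m, m ∉ Set.range (msg r) → prob (r.tree.run x y) {z | z.1 = m} = 0 := by
    intro r x y m hm
    rw [hrun]
    refine Finset.sum_eq_zero fun u _ => ?_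
    have : msg r u ≠ m := fun h => hm ⟨u, h⟩
    simp [this]
  have hw1 := sum_toReal_eq_one μ
  have hw1' : ∑ y, ∑ x, (μ (x, y)).toReal = 1 := by rw [Finset.sum_comm]; exact hw1
  have info1 := hasSum_channelInfo (π.execution μ) Execution.x Execution.y Execution.transcript
    (fun r => (π r).toReal) (fun x y => (μ (x, y)).toReal) msg
    (fun r x y u => a r x u * b r y u) (fun r => ENNReal.toReal_nonneg) (hasSum_toReal π)
    (fun _ _ => ENNReal.toReal_nonneg) hw1' hinj
    (fun r x y u => mul_nonneg (ha r x u) (hb r y u)) hab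
    (fun x y => by
      rw [← prob_execution_inputs π μ x y]; rfl)
    (fun x y r u => by
      rw [← hmsg, ← prob_execution_transcript]
      congr 1; ext ω; simp only [Set.mem_inter_iff, Set.mem_ofPred_eq, Prod.mk.injEq]; tauto)
    (fun x y r m hm => by
      rw [← mul_zero (π r).toReal, ← mul_zero (μ (x, y)).toReal, ← hmsg0 r x y m hm,
        ← prob_execution_transcript]
      congr 1; ext ω; simp only [Set.mem_inter_iff, Set.mem_ofPred_eq, Prod.mk.injEq]; tauto)
  have info2 := hasSum_channelInfo (π.execution μ) Execution.y Execution.x Execution.transcript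
    (fun r => (π r).toReal) (fun y x => (μ (x, y)).toReal) msg
    (fun r y x u => a r x u * b r y u) (fun r => ENNReal.toReal_nonneg) (hasSum_toReal π)
    (fun _ _ => ENNReal.toReal_nonneg) hw1 hinj
    (fun r y x u => mul_nonneg (ha r x u) (hb r y u)) (fun r y x => hab r x y)
    (fun y x => by
      rw [← prob_execution_inputs π μ x y]
      congr 1; ext ω; simp only [Set.mem_inter_iff, Set.mem_ofPred_eq]; tauto)
    (fun y x r u => by
      rw [← hmsg, ← prob_execution_transcript]
      congr 1; ext ω; simp only [Set.mem_inter_iff, Set.mem_ofPred_eq, Prod.mk.injEq]; tauto)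
    (fun y x r m hm => by
      rw [← mul_zero (π r).toReal, ← mul_zero (μ (x, y)).toReal, ← hmsg0 r x y m hm,
        ← prob_execution_transcript]
      congr 1; ext ω; simp only [Set.mem_inter_iff, Set.mem_ofPred_eq, Prod.mk.injEq]; tauto)
  have err : HasSum (fun r => (π r).toReal * ∑ x, ∑ y, (μ (x, y)).toReal *
      ∑ u, a r x u * b r y u * (sign (o r u) * sign (f x y))) (1 - 2 * π.errorProb f μ) := by
    have h := (hasSum_toReal π).sub
      ((hasSum_prob_execution π μ {w | w.output ≠ f w.x w.y}).mul_left 2)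
    refine (congrArg (fun g => HasSum g _) (funext fun r => ?_)).mpr h
    have e : ∀ x y, prob (r.tree.run x y) {z | (⟨x, y, (r, z.1), z.2⟩ : Execution X Y) ∈
        {w : Execution X Y | w.output ≠ f w.x w.y}} =
        ∑ u, a r x u * b r y u * if o r u ≠ f x y then 1 else 0 := fun x y => by
      rw [hrun]
      refine Finset.sum_congr rfl fun u _ => ?_
      by_cases hne : o r u = f x y <;> simp [hne]
    have e' : ∀ x y, ∑ u, a r x u * b r y u * (sign (o r u) * sign (f x y)) =
        1 - 2 * ∑ u, a r x u * b r y u * if o r u ≠ f x y then 1 else 0 := fun x y => by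
      simp only [sign_mul_sign, mul_sub, mul_one, Finset.sum_sub_distrib, hab]
      rw [Finset.mul_sum]
      exact congrArg _ (Finset.sum_congr rfl fun u _ => by ring)
    simp only [e, e', mul_sub, mul_one, Finset.sum_sub_distrib, hw1, Finset.mul_sum]
    congr 1
    simp only [mul_left_comm]
  set c : PrivateProtocol X Y → ℝ := fun r => ∑ x, ∑ y, (μ (x, y)).toReal *
      ∑ u, a r x u * b r y u * (sign (o r u) * sign (f x y)) -
        t * (channelInfo (fun x y => (μ (x, y)).toReal) (fun x y u => a r x u * b r y u) +
          channelInfo (fun y x => (μ (x, y)).toReal) (fun y x u => a r x u * b r y u)) with hc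
  set v : ℝ := 1 - 2 * π.errorProb f μ - t * π.infoCost μ with hv
  -- The deficits `v - c r` average to zero over the coin. If all were positive, every coin would
  -- have probability zero.
  have total : HasSum (fun r => (π r).toReal * (v - c r)) 0 := by
    have h1 := (hasSum_toReal π).mul_right v
    have h2 := err.sub ((info1.add info2).mul_left t)
    have h3 := h1.sub h2
    have e : 1 * v - (1 - 2 * π.errorProb f μ - t *
        (condMutualInfo (π.execution μ) Execution.x Execution.transcript Execution.y +
        condMutualInfo (π.execution μ) Execution.y Execution.transcript Execution.x)) = 0 := by
      rw [hv, Protocol.infoCost]; ring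
    rw [e] at h3
    refine (congrArg (fun g => HasSum g _) (funext fun r => ?_)).mpr h3
    simp only [hc]; ring
  suffices h : ∃ r, v ≤ c r by
    obtain ⟨r, hr⟩ := h
    exact ⟨U r, instU r, a r, b r, o r, ha r, hb r, hab r, hr⟩
  by_contra! hcon
  rw [hasSum_zero_iff_of_nonneg fun r =>
    mul_nonneg ENNReal.toReal_nonneg (sub_nonneg.2 (hcon r).le)] at total
  have hz : (fun r => (π r).toReal) = 0 := by
    funext r
    have h := congrFun total r
    rcases mul_eq_zero.1 h with h | h
    · exact h
    · exact absurd h (sub_pos.2 (hcon r)).ne'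
  have h1 := hasSum_toReal π
  rw [hz] at h1
  exact zero_ne_one (hasSum_zero.unique h1)

/-! ### Deterministic protocols -/

/-- The probability of an event on the output of a deterministic tree. -/
theorem prob_execution_pure {P : Player} (T : ProtocolTree X Y P) (out : X → Y → Bool)
    (hT : ∀ x y, ∃ m, T.run x y = PMF.pure (m, out x y)) (μ : PMF (X × Y))
    (C : X → Y → Bool → Prop) [∀ x y c, Decidable (C x y c)] :
    prob (Protocol.execution (PMF.pure ⟨P, T⟩) μ) {ω | C ω.x ω.y ω.output} =
      ∑ x, ∑ y, (μ (x, y)).toReal * if C x y (out x y) then 1 else 0 := by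
  have h := hasSum_prob_execution (PMF.pure ⟨P, T⟩) μ {ω | C ω.x ω.y ω.output}
  rw [h.unique (hasSum_single ⟨P, T⟩ fun r' hr' => by
    rw [PMF.pure_apply_of_ne _ _ hr']; simp)]
  rw [PMF.pure_apply_self, ENNReal.toReal_one, one_mul]
  refine Finset.sum_congr rfl fun x _ => Finset.sum_congr rfl fun y _ => ?_
  obtain ⟨m, hm⟩ := hT x y
  rw [hm, prob_pure]
  exact congrArg _ (if_congr Iff.rfl rfl rfl)

theorem successProb_pure {P : Player} (T : ProtocolTree X Y P) (out : X → Y → Bool)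
    (hT : ∀ x y, ∃ m, T.run x y = PMF.pure (m, out x y)) (f : X → Y → Bool) (μ : PMF (X × Y)) :
    Protocol.successProb (PMF.pure ⟨P, T⟩) f μ =
      1 / 2 + (∑ x, ∑ y, (μ (x, y)).toReal * sign (f x y) * sign (out x y)) / 2 := by
  classical
  have key : ∀ x y, (μ (x, y)).toReal * (if out x y = f x y then 1 else 0) =
      (μ (x, y)).toReal / 2 + (μ (x, y)).toReal * sign (f x y) * sign (out x y) / 2 := by
    intro x y
    rw [mul_assoc, sign_mul_sign]
    by_cases h : out x y = f x y
    · simp [h]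
    · simp only [h, if_false, ne_eq, Ne.symm h, not_false_eq_true, if_true]
      ring
  rw [Protocol.successProb, prob_execution_pure T out hT μ fun x y c => c = f x y]
  simp only [key, Finset.sum_add_distrib, ← Finset.sum_div, sum_toReal_eq_one]

/-- Both players reveal their inputs and the output is `f x y`. -/
noncomputable def revealTree (f : X → Y → Bool) : ProtocolTree X Y Player.A :=
  .nodeA unaryLabel unaryLabel_prefixFree (fun x => PMF.pure (Fintype.equivFin X x))
    fun i => .nodeB unaryLabel unaryLabel_prefixFree (fun y => PMF.pure (Fintype.equivFin Y y))
      fun j => .leaf (f ((Fintype.equivFin X).symm i) ((Fintype.equivFin Y).symm j))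

theorem revealTree_run (f : X → Y → Bool) (x : X) (y : Y) :
    ∃ m, (revealTree f).run x y = PMF.pure (m, f x y) := by
  exact ⟨_, by simp [revealTree, ProtocolTree.run, PMF.pure_bind, PMF.pure_map]; rfl⟩

/-- It makes the set in the definition of `infoComplexity` nonempty, so that the infimum can be
approached by actual protocols. -/
theorem errorProb_reveal (f : X → Y → Bool) (μ : PMF (X × Y)) :
    Protocol.errorProb (PMF.pure ⟨_, revealTree f⟩) f μ = 0 := by
  classical
  rw [Protocol.errorProb, prob_execution_pure _ f (revealTree_run f) μ fun x y c => c ≠ f x y]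
  simp

end Trees

/-! ### Replacing a protocol by one or two bits -/

section Main

variable {X Y : Type*} [Fintype X] [Fintype Y]

/-- A negative cost could be weighted so heavily in the trade-off that some channel, whose
informations are nonnegative, would have correlation above one. The function `f` plays no role and
is taken constant. -/
theorem infoCost_nonneg (π : Protocol X Y) (μ : PMF (X × Y)) : 0 ≤ π.infoCost μ := by
  by_contra! hneg
  set f : X → Y → Bool := fun _ _ => true
  have herr : π.errorProb f μ ≤ 1 := prob_le_one _ _
  obtain ⟨U, _, a, b, o, ha, hb, hab, h⟩ :=
    -- With this weight the left side of the trade-off is at least `1 - 2 + 3 = 2`.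
    exists_channel_of_protocol π f μ (3 / -π.infoCost μ)
  have ht : 0 < 3 / -π.infoCost μ := div_pos three_pos (neg_pos.2 hneg)
  have e : 3 / -π.infoCost μ * π.infoCost μ = -3 := by
    have := hneg.ne
    field_simp
  have hw1 := sum_toReal_eq_one μ
  have hw1' : ∑ y, ∑ x, (μ (x, y)).toReal = 1 := by rw [Finset.sum_comm]; exact hw1
  have h1 := channelInfo_nonneg (fun x y => (μ (x, y)).toReal) (fun x y u => a x u * b y u)
    (fun _ _ => ENNReal.toReal_nonneg) hw1' (fun x y u => mul_nonneg (ha x u) (hb y u)) hab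
  have h2 := channelInfo_nonneg (fun y x => (μ (x, y)).toReal) (fun y x u => a x u * b y u)
    (fun _ _ => ENNReal.toReal_nonneg) hw1 (fun y x u => mul_nonneg (ha x u) (hb y u))
    (fun y x => hab x y)
  have h3 : ∑ x, ∑ y, (μ (x, y)).toReal * ∑ u, a x u * b y u * (sign (o u) * sign (f x y)) ≤ 1 := by
    rw [← hw1]
    refine Finset.sum_le_sum fun x _ => Finset.sum_le_sum fun y _ => ?_
    refine mul_le_of_le_one_right ENNReal.toReal_nonneg ?_
    rw [← hab x y]
    refine Finset.sum_le_sum fun u _ => mul_le_of_le_one_right (mul_nonneg (ha x u) (hb y u)) ?_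
    refine (le_abs_self _).trans ?_
    rw [abs_mul, abs_sign, abs_sign, one_mul]
  have h4 := mul_nonneg ht.le (add_nonneg h1 h2)
  linarith

/-- A protocol of small information cost is replaced by a single bit sent by the first player. -/
theorem exists_oneBit (π : Protocol X Y) (f : X → Y → Bool) (μ : PMF (X × Y))
    (hπ : π.errorProb f μ ≤ 1 / 10) (hinfo : π.infoCost μ ≤ 1 / 1000) :
    ∃ s : X → Bool, 3 / 4 ≤ Protocol.successProb (PMF.pure ⟨_, oneBitTree s⟩) f μ := by
  -- The weight equals the coefficient of the information in `exists_bounded_left_of_channelInfo` at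
  -- `c = 10`. The correlation left is at least `4/5 - 20/1000 - 2/10`, which exceeds the required
  -- 1/2.
  obtain ⟨U, _, a, b, o, ha, hb, hab, h⟩ :=
    exists_channel_of_protocol π f μ (2 * (10 * Real.log 2))
  have hw1 := sum_toReal_eq_one μ
  have hw1' : ∑ y, ∑ x, (μ (x, y)).toReal = 1 := by rw [Finset.sum_comm]; exact hw1
  have h1 := channelInfo_nonneg (fun x y => (μ (x, y)).toReal) (fun x y u => a x u * b y u)
    (fun _ _ => ENNReal.toReal_nonneg) hw1' (fun x y u => mul_nonneg (ha x u) (hb y u)) hab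
  obtain ⟨g, hg, hcor⟩ := exists_bounded_left_of_channelInfo (fun x y => (μ (x, y)).toReal)
    (fun x y => sign (f x y)) (fun x y u => a x u * b y u) (fun u => sign (o u))
    (fun _ _ => ENNReal.toReal_nonneg) hw1 (fun x y => (abs_sign _).le)
    (fun x y u => mul_nonneg (ha x u) (hb y u)) hab (fun u => (abs_sign _).le)
    (c := 10) (by norm_num)
  obtain ⟨s, hs⟩ := exists_sign_ge (fun x => ∑ y, (μ (x, y)).toReal * sign (f x y)) g hg
  refine ⟨s, ?_⟩
  rw [successProb_pure _ (fun x _ => s x) (oneBitTree_run s)]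
  simp only [← Finset.sum_mul] at hcor
  have hs' : ∑ x, ∑ y, (μ (x, y)).toReal * sign (f x y) * sign (s x) =
      ∑ x, (∑ y, (μ (x, y)).toReal * sign (f x y)) * (if s x then 1 else -1) :=
    Finset.sum_congr rfl fun x _ => (Finset.sum_mul _ _ _).symm
  rw [hs']
  have hlog := Real.log_two_lt_d9
  have hlog0 : 0 < Real.log 2 := Real.log_pos (by norm_num)
  have h4 : 2 * (10 * Real.log 2) * π.infoCost μ ≤ 2 * (10 * 1) * (1 / 1000) := by
    calc _ ≤ 2 * (10 * Real.log 2) * (1 / 1000) := by gcongr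
      _ ≤ _ := by gcongr; linarith
  have h5 := mul_nonneg hlog0.le h1
  linarith

/-- A protocol of information cost small compared to `K` is replaced by one bit from each player. -/
theorem exists_twoBit (π : Protocol X Y) (f : X → Y → Bool) (μ : PMF (X × Y))
    (hπ : π.errorProb f μ ≤ 1 / 10) {K : ℝ} (hK : 0 < K) (hinfo : (π.infoCost μ + 4) / K < 3 / 10) :
    ∃ (s : X → Bool) (t : Y → Bool), 1 / 2 + (2 : ℝ) ^ (-(3 * K) - 7) ≤
      Protocol.successProb (PMF.pure ⟨_, twoBitTree s t⟩) f μ := by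
  -- The weight `1 / K` is the rate at which the tail bounds charge information; `hinfo` says that
  -- `4/5` minus all losses still exceeds 1/2.
  obtain ⟨U, _, a, b, o, ha, hb, hab, h⟩ := exists_channel_of_protocol π f μ (1 / K)
  have hw1 := sum_toReal_eq_one μ
  obtain ⟨g, k, hg, hk, hcor⟩ := exists_bounded_of_channelInfo (fun x y => (μ (x, y)).toReal)
    (fun x y => sign (f x y)) a b (fun u => sign (o u))
    (fun _ _ => ENNReal.toReal_nonneg) hw1 (fun x y => (abs_sign _).le)
    ha hb hab (fun u => (abs_sign _).le) hK (by
      rw [add_div] at hinfo ⊢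
      rw [add_div]
      rw [mul_add, one_div_mul_eq_div, one_div_mul_eq_div, one_div_mul_eq_div] at h
      have : 4 / K = 2 / K + 2 / K := by ring
      linarith)
  -- The correlation is linear in each function separately, so `g` is rounded with `k` fixed, then
  -- `k` with the signs `s` fixed.
  obtain ⟨s, hs⟩ := exists_sign_ge (fun x => ∑ y, (μ (x, y)).toReal * sign (f x y) * k y) g hg
  obtain ⟨t, ht⟩ := exists_sign_ge
    (fun y => ∑ x, (μ (x, y)).toReal * sign (f x y) * (if s x then 1 else -1)) k hk
  refine ⟨s, t, ?_⟩
  rw [successProb_pure _ (fun x y => s x == t y) (twoBitTree_run s t)]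
  have e1 : ∑ x, ∑ y, (μ (x, y)).toReal * sign (f x y) * (g x * k y) =
      ∑ x, (∑ y, (μ (x, y)).toReal * sign (f x y) * k y) * g x := by
    refine Finset.sum_congr rfl fun x _ => ?_
    rw [Finset.sum_mul]
    exact Finset.sum_congr rfl fun y _ => by ring
  have e2 : ∑ x, (∑ y, (μ (x, y)).toReal * sign (f x y) * k y) * (if s x then 1 else -1) =
      ∑ y, (∑ x, (μ (x, y)).toReal * sign (f x y) * (if s x then 1 else -1)) * k y := by
    simp only [Finset.sum_mul]
    rw [Finset.sum_comm]
    exact Finset.sum_congr rfl fun y _ => Finset.sum_congr rfl fun x _ => by ring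
  have e3 : ∑ y, (∑ x, (μ (x, y)).toReal * sign (f x y) * (if s x then 1 else -1)) *
      (if t y then 1 else -1) = ∑ x, ∑ y, (μ (x, y)).toReal * sign (f x y) *
        sign (s x == t y) := by
    simp only [Finset.sum_mul]
    rw [Finset.sum_comm]
    refine Finset.sum_congr rfl fun x _ => Finset.sum_congr rfl fun y _ => ?_
    cases s x <;> cases t y <;> simp [sign]
  -- Here `64 = 2 ^ 6`, and the last factor 1/2 converts correlation into success probability.
  have e4 : (2 : ℝ) ^ (-(3 * K) - 7) = 1 / (64 * ((2 : ℝ) ^ K) ^ 3) / 2 := by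
    rw [Real.rpow_sub (by norm_num), Real.rpow_neg (by norm_num), mul_comm 3 K,
      Real.rpow_mul (by norm_num)]
    norm_num
    ring
  rw [e4, ← e3]
  rw [e1] at hcor
  rw [e2] at hs
  linarith

end Main

end InfoComm

theorem theorem2 {X Y : Type*} [Finite X] [Finite Y] (f : X → Y → Bool) (μ : PMF (X × Y))
    (I : ℝ) (hI : InfoComm.infoComplexity f μ (1 / 10) = I) :
    ∃ π' : InfoComm.Protocol X Y,
      π'.commCost ≤ ENNReal.ofReal (max 1 (4220 * I)) ∧
      π'.successProb f μ ≥ 1 / 2 + (2 : ℝ) ^ (-(1000 * (I + 1)) - 4) := by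
  classical
  have := Fintype.ofFinite X
  have := Fintype.ofFinite Y
  -- The infimum need not be attained. The slack keeps the cost below 1/1000 in the case `4220 * I <
  -- 2`, and with `hlow` it gives `I > -1/10000`.
  obtain ⟨_, ⟨π, hπ, rfl⟩, hπI⟩ := exists_lt_of_csInf_lt
    (s := {c : ℝ | ∃ π : InfoComm.Protocol X Y, π.errorProb f μ ≤ 1 / 10 ∧ π.infoCost μ = c})
    (b := I + 1 / 10000)
    ⟨_, PMF.pure ⟨_, InfoComm.revealTree f⟩, by rw [InfoComm.errorProb_reveal]; norm_num, rfl⟩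
    (by rw [InfoComm.infoComplexity] at hI; rw [hI]; linarith)
  have hlow := InfoComm.infoCost_nonneg π μ
  -- Two bits are affordable exactly when `4220 * I ≥ 2`.
  rcases lt_or_ge (4220 * I) 2 with hsmall | hlarge
  · obtain ⟨s, hs⟩ := InfoComm.exists_oneBit π f μ hπ (by linarith)
    refine ⟨_, (InfoComm.commCost_pure_le _ (InfoComm.oneBitTree_cost s)).trans ?_, ?_⟩
    · rw [Nat.cast_one, ← ENNReal.ofReal_one]
      exact ENNReal.ofReal_le_ofReal (le_max_left _ _)
    · have h : (2 : ℝ) ^ (-(1000 * (I + 1)) - 4) ≤ (2 : ℝ) ^ (-2 : ℝ) :=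
        Real.rpow_le_rpow_of_exponent_le (by norm_num) (by linarith)
      rw [Real.rpow_neg (by norm_num)] at h
      norm_num at h
      linarith
  -- This `K` makes the losses `(I + 4 + 1/10000) / K` less than 3/10, while `3 * K + 7` stays below
  -- `1000 * (I + 1) + 4`.
  · obtain ⟨s, t, hst⟩ := InfoComm.exists_twoBit π f μ hπ (K := 100 * (I + 1)) (by linarith)
      (by rw [div_lt_iff₀ (by linarith)]; linarith)
    refine ⟨_, (InfoComm.commCost_pure_le _ (InfoComm.twoBitTree_cost s t)).trans ?_, ?_⟩
    · rw [show ((2 : ℕ) : ℝ≥0∞) = ENNReal.ofReal 2 by norm_num]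
      exact ENNReal.ofReal_le_ofReal (hlarge.trans (le_max_right _ _))
    · have h : (2 : ℝ) ^ (-(1000 * (I + 1)) - 4) ≤ (2 : ℝ) ^ (-(3 * (100 * (I + 1))) - 7) :=
        Real.rpow_le_rpow_of_exponent_le (by norm_num) (by linarith)
      linarith
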